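/- An \emph{agenda} for the players $\{1,\dots,n\}$ is a finite sequence $A$ over $\{|,1,\dots,n\}$, where $|$ is called a separator. Let $k_i$ be the number of occurrences of player $i$ in $A$ (the number of nodes of $i$) and $k_|$ the number of occurrences of $|$. For discrete random variables $Y,Z$ let $\delta(Y,Z)=\sum_x\max(\Pr(Y=x)-\Pr(Z=x),0)$ be the total variation distance. An \emph{$(\epsilon,\lambda)$-timing} of $A$ is a discrete random tuple $X$ of real numbers $X_{|,j}$ ($1\le j\le k_|$) and $X_{i,j}$ ($1\le i\le n$, $1\le j\le k_i$) such that always (1) $X_{|,j}\ge 0$; (2) $X_{|,j}+1\le X_{|,j+1}$; (3) $X_{i,j}<X_{i,j+1}$; (4) $X_{i,j_1}\le X_{|,j_2}+\lambda$ whenever the $j_1$-th occurrence of $i$ in $A$ is before the $j_2$-th occurrence of $|$; (5) $X_{i,j_1}\ge X_{|,j_2}-\lambda$ whenever the $j_1$-th occurrence of $i$ in $A$ is after the $j_2$-th occurrence of $|$; and (6) $\delta\big((X_{i,1},\dots,X_{i,k_i}),(X_{i',1},\dots,X_{i',k_{i'}})\big)\le\epsilon$ whenever $k_i=k_{i'}$.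 We say that $X$ needs time at least $T$ if with positive probability at least one entry of $X$ is at least $T$. Let $\exp_2(x)=2^x$ and let $\exp_2^r$ be its $r$-fold iterate. Theorem. For every integer $r\ge 1$ there exist real numbers $k_r,\epsilon_r>0$ and an agenda $A_r$ for $16r-13$ players, with at most $3(r-1)$ nodes per player if $r\ge 2$ and at most $3$ nodes per player if $r=1$, such that for every $\epsilon$ with $0<\epsilon\le\epsilon_r$, every $\left(\epsilon,\tfrac{1}{10}\epsilon^{1-\frac1r}\right)$-timing of $A_r$ needs time at least $$\exp_2^r\left(k_r\,\epsilon^{-\frac{1}{r!\,(r-1)!}}\right).$$ -/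

import Mathlib

open scoped ENNReal Nat

/-- The total variation distance `δ(X₁, X₂) = ∑ₓ max (Pr(X₁ = x) - Pr(X₂ = x), 0)` of two discrete
distributions. Subtraction in `ℝ≥0∞` is truncated at `0`, so it is exactly this maximum. -/
noncomputable def tvDist {α : Type*} (p q : PMF α) : ℝ≥0∞ := ∑' x, (p x - q x)

/-- The symbols of an agenda for `n` players: the separator `|` and the players. -/
inductive AgendaSymbol (n : ℕ) : Type
  | sep : AgendaSymbol n
  | player (i : Fin n) : AgendaSymbol n
  deriving DecidableEq

/-- An agenda for `n` players is a finite sequence of separators and players. -/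
abbrev Agenda (n : ℕ) : Type := List (AgendaSymbol n)

namespace Agenda

open AgendaSymbol

variable {n : ℕ}

/-- The `j`-th occurrence (counted from `0`) of the symbol `a` in `A` is at position `p`. -/
def IsOcc (A : Agenda n) (a : AgendaSymbol n) (j p : ℕ) : Prop :=
  A[p]? = some a ∧ (A.take p).count a = j

/-- The `j₁`-th occurrence of `a` in `A` is before the `j₂`-th occurrence of `b`
(occurrences counted from `0`). -/
def OccBefore (A : Agenda n) (a : AgendaSymbol n) (j₁ : ℕ) (b : AgendaSymbol n) (j₂ : ℕ) : Prop :=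
  ∃ p q : ℕ, A.IsOcc a j₁ p ∧ A.IsOcc b j₂ q ∧ p < q

/-- A tuple of real times, one for each occurrence of each symbol in `A`:
`x sep j` is the time of the `j`-th separator and `x (player i) j` is the time of the `j`-th
node of player `i`. -/
abbrev Times (A : Agenda n) : Type := (a : AgendaSymbol n) → Fin (A.count a) → ℝ

/-- The (discrete) random tuple with law `X` is an `(ε, lam)`-timing of the agenda `A`. -/
structure IsTiming (A : Agenda n) (ε lam : ℝ) (X : PMF A.Times) : Prop where
  sep_nonneg : ∀ x ∈ X.support, ∀ j, 0 ≤ x sep j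
  sep_gap : ∀ x ∈ X.support, ∀ j₁ j₂ : Fin (A.count sep),
    j₁.val + 1 = j₂.val → x sep j₁ + 1 ≤ x sep j₂
  node_lt : ∀ x ∈ X.support, ∀ i, ∀ j₁ j₂ : Fin (A.count (player i)),
    j₁.val + 1 = j₂.val → x (player i) j₁ < x (player i) j₂
  before_sep : ∀ x ∈ X.support, ∀ i, ∀ j₁ : Fin (A.count (player i)), ∀ j₂ : Fin (A.count sep),
    A.OccBefore (player i) j₁ sep j₂ → x (player i) j₁ ≤ x sep j₂ + lam
  after_sep : ∀ x ∈ X.support, ∀ i, ∀ j₁ : Fin (A.count (player i)), ∀ j₂ : Fin (A.count sep),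
    A.OccBefore sep j₂ (player i) j₁ → x sep j₂ - lam ≤ x (player i) j₁
  tvDist_le : ∀ (i i' : Fin n) (h : A.count (player i) = A.count (player i')),
    tvDist (X.map fun x => x (player i))
      (X.map fun x => fun j => x (player i') (Fin.cast h j)) ≤ ENNReal.ofReal ε

/-- The random tuple with law `X` needs time at least `T`: with positive probability some
node or separator gets a time that is at least `T`. In particular, if all times are at most `N`
almost surely, then `T ≤ N`. -/
def NeedsTime {A : Agenda n} (X : PMF A.Times) (T : ℝ) : Prop :=
  ∃ x ∈ X.support, ∃ (a : AgendaSymbol n) (j : Fin (A.count a)), T ≤ x a j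

end Agenda

/-- The `r`-fold iterate of `x ↦ 2 ^ x`: a tower of `r` twos with `x` on top. -/
noncomputable def expTwoIter (r : ℕ) (x : ℝ) : ℝ := (fun y : ℝ => (2 : ℝ) ^ y)^[r] x

/-!
The separators only serve to order the nodes: between any two nodes that have to be ordered the
agenda places so many separators that the later node is later by at least `40`
(`exists_agenda_of_isHard`). What remains is a statement about random vectors with nearly equal
laws, one for each player, whose entries are ordered in a prescribed way (`IsSystem`, `IsHard`).

*Height one.* Three players with two nodes each are arranged so that the gap of the first contains
the disjoint gaps of the other two. The expected logarithm of the gap then exceeds the average of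
two nearly equal numbers by a constant. As the laws differ by `ε` in total variation, the
logarithm of the gap has range of order `1 / ε` (`NearLaw.two_rpow_le`, `isHard_one`).

*One more exponential.* Auxiliary players are added that force the gaps of every player to behave
geometrically.
* If the quotient `R` of two successive gaps of one player dominates the sum of those of two
  others, then comparing the expectations of `R / (1 + R)` shows that `R` lies between two
  fixed positive bounds only with probability `O(ε)` (`NearLaw.measureReal_ratio_le`). Nesting of
  gaps makes this happen for all pairs of successive gaps with only three auxiliary players.
* A monotone comparison between events of nearly equal probability is nearly an equality. Thus, by
  further nestings, whether a gap is much longer or much shorter than the preceding one depends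
  neither on the place (`HasSigns.upEvent_diff_succ_le`) nor on the player
  (`HasSteadySigns.exists_event`).

So one of two events, all gaps growing or all gaps shrinking geometrically, has probability at
least `1 / 4`. Conditioned on it, the logarithms of the distances of a node to the first node of
its player, or the negated logarithms of the distances to the last one, are again times of the
same kind (`IsConfig.log_up`, `IsConfig.log_down`), with `ε` multiplied by a constant. Hence a
system with two more nodes per player and twelve more players gains one exponential
(`isHard_levelPos`), which gives `2 r` nodes per player and `12 r - 9` players at height `r`
(`exists_isHard`).

For `r = 2` only three nodes are allowed. There the quotients of successive gaps are used
directly: one of them, or of their inverses, dominates the product of two others (`isHard_two`).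

All bounds obtained are towers with `1 / ε` on top, which is at least the power of `1 / ε`
required.
-/
open MeasureTheory ProbabilityTheory

/-! ### Random elements with nearly equal laws -/

/-- The laws under `μ` of the random elements `u i` differ pairwise by at most `ε` in total
variation. The sets are arbitrary: all spaces `Ω` below carry a discrete σ-algebra. -/
def NearLaw {Ω β ι : Type*} [MeasurableSpace Ω] (μ : Measure Ω) (ε : ℝ) (u : ι → Ω → β) : Prop :=
  ∀ i i' (S : Set β), μ.real (u i ⁻¹' S) ≤ μ.real (u i' ⁻¹' S) + ε

section NearLaw

variable {Ω β γ ι : Type*} [MeasurableSpace Ω] {μ : Measure Ω} {ε : ℝ} {u : ι → Ω → β}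

theorem NearLaw.map (h : NearLaw μ ε u) (f : β → γ) : NearLaw μ ε fun i ω => f (u i ω) :=
  fun i i' S => h i i' (f ⁻¹' S)

theorem NearLaw.comp {κ : Type*} (h : NearLaw μ ε u) (e : κ → ι) : NearLaw μ ε fun i => u (e i) :=
  fun i i' S => h (e i) (e i') S

theorem measureReal_le_of_ae [IsFiniteMeasure μ] {A B : Set Ω} (h : ∀ᵐ ω ∂μ, ω ∈ A → ω ∈ B) :
    μ.real A ≤ μ.real B :=
  ENNReal.toReal_mono (measure_ne_top _ _) (measure_mono_ae h)

theorem measureReal_diff_le_add [IsFiniteMeasure μ] (A B C : Set Ω) :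
    μ.real (A \ C) ≤ μ.real (A \ B) + μ.real (B \ C) := by
  refine (measureReal_mono ?_).trans (measureReal_union_le _ _)
  rintro ω ⟨a, c⟩
  by_cases b : ω ∈ B
  exacts [Or.inr ⟨b, c⟩, Or.inl ⟨a, b⟩]

variable [DiscreteMeasurableSpace Ω] [IsFiniteMeasure μ]

theorem integrable_of_ae_bounds {f : Ω → ℝ} {B : ℝ} (h0 : ∀ᵐ ω ∂μ, 0 ≤ f ω)
    (h1 : ∀ᵐ ω ∂μ, f ω ≤ B) : Integrable f μ := by
  refine Integrable.of_bound (C := B) Measurable.of_discrete.aestronglyMeasurable ?_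
  filter_upwards [h0, h1] with ω a b
  rwa [Real.norm_eq_abs, abs_of_nonneg a]

/-- Layer cake: the expectations of a function with values in `[0, B]` differ by at most `B * ε`.
-/
theorem NearLaw.integral_le (h : NearLaw μ ε u) (f : β → ℝ) {B : ℝ} (hB : 0 ≤ B)
    (h0 : ∀ i, ∀ᵐ ω ∂μ, 0 ≤ f (u i ω)) (h1 : ∀ i, ∀ᵐ ω ∂μ, f (u i ω) ≤ B) (i i' : ι) :
    ∫ ω, f (u i ω) ∂μ ≤ ∫ ω, f (u i' ω) ∂μ + B * ε := by
  have hanti : ∀ i, IntegrableOn (fun t => μ.real {ω | t ≤ f (u i ω)}) (Set.Ioc 0 B) := by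
    intro i
    have : Antitone fun t => μ.real {ω | t ≤ f (u i ω)} := fun s t hst =>
      measureReal_mono fun ω (hω : t ≤ _) => hst.trans hω
    exact ((this.antitoneOn (Set.Icc 0 B)).integrableOn_isCompact isCompact_Icc).mono_set
      Set.Ioc_subset_Icc_self
  rw [(integrable_of_ae_bounds (h0 i) (h1 i)).integral_eq_integral_Ioc_meas_le (h0 i) (h1 i),
    (integrable_of_ae_bounds (h0 i') (h1 i')).integral_eq_integral_Ioc_meas_le (h0 i') (h1 i')]
  calc ∫ t in Set.Ioc 0 B, μ.real {ω | t ≤ f (u i ω)}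
      ≤ ∫ t in Set.Ioc 0 B, (μ.real {ω | t ≤ f (u i' ω)} + ε) := by
        refine setIntegral_mono (hanti i) ((hanti i').add (by simp)) fun t => ?_
        exact h i i' {b | t ≤ f b}
    _ = _ := by
        rw [integral_add (hanti i') (by simp)]
        simp [hB]

/-- If `A ⊆ B` up to `δ` and `B` is not much more likely than `A`, then the two events nearly
agree. This turns one-sided comparisons between players with nearly equal laws into two-sided
ones. -/
theorem measureReal_diff_le_of_le {A B : Set Ω} {δ : ℝ} (hA : μ.real (A \ B) ≤ δ)
    (hB : μ.real B ≤ μ.real A + ε) : μ.real (B \ A) ≤ δ + ε := by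
  have e1 := measureReal_sdiff_add_inter (μ := μ) (s := A) (t := B) (MeasurableSet.of_discrete)
  have e2 := measureReal_sdiff_add_inter (μ := μ) (s := B) (t := A) (MeasurableSet.of_discrete)
  rw [Set.inter_comm] at e2
  linarith

end NearLaw

section Doubling

variable {Ω ι : Type*} [MeasurableSpace Ω] [DiscreteMeasurableSpace Ω] {μ : Measure Ω}
  [IsProbabilityMeasure μ] {ε : ℝ}

/-- If one of three nearly equidistributed variables dominates `3 / 4` of the sum of the other
two, then its expected logarithm exceeds the average of theirs by a constant. Expected logarithms
differ by at most `ε * logb 2 M`, so the bound `M` is exponential in `1 / ε`. -/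
theorem NearLaw.two_rpow_le (hε : 0 < ε) {D : ι → Ω → ℝ} (h : NearLaw μ ε D) {M : ℝ}
    (h1 : ∀ i, ∀ᵐ ω ∂μ, 1 ≤ D i ω) (hM : ∀ i, ∀ᵐ ω ∂μ, D i ω ≤ M) (a b c : ι)
    (hsum : ∀ᵐ ω ∂μ, 3 / 4 * (D b ω + D c ω) ≤ D a ω) : (2 : ℝ) ^ (1 / 2 / ε) ≤ M := by
  have hM1 : 1 ≤ M := by
    obtain ⟨ω, p, q⟩ := ((h1 a).and (hM a)).exists
    exact p.trans q
  have f0 : ∀ i, ∀ᵐ ω ∂μ, 0 ≤ Real.logb 2 (D i ω) := fun i => by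
    filter_upwards [h1 i] with ω p using Real.logb_nonneg (by norm_num) p
  have f1 : ∀ i, ∀ᵐ ω ∂μ, Real.logb 2 (D i ω) ≤ Real.logb 2 M := fun i => by
    filter_upwards [h1 i, hM i] with ω p q
    exact Real.logb_le_logb_of_le (by norm_num) (by linarith) q
  have B0 : 0 ≤ Real.logb 2 M := Real.logb_nonneg (by norm_num) hM1
  have iab := h.integral_le (Real.logb 2) B0 f0 f1 a b
  have iac := h.integral_le (Real.logb 2) B0 f0 f1 a c
  have key : ∫ ω, (1 / 2 + 1 / 2 * (Real.logb 2 (D b ω) + Real.logb 2 (D c ω))) ∂μ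
      ≤ ∫ ω, Real.logb 2 (D a ω) ∂μ := by
    refine integral_mono_ae ?_ (integrable_of_ae_bounds (f0 a) (f1 a)) ?_
    · exact (integrable_const _).add (((integrable_of_ae_bounds (f0 b) (f1 b)).add
        (integrable_of_ae_bounds (f0 c) (f1 c))).const_mul _)
    · filter_upwards [h1 a, h1 b, h1 c, hsum] with ω ha hb hc hs
      have hbc : 2 * (D b ω * D c ω) ≤ D a ω ^ 2 := by
        nlinarith [sq_nonneg (D b ω - D c ω),
          mul_pos (by linarith : 0 < D b ω) (by linarith : 0 < D c ω)]
      have := Real.logb_le_logb_of_le (b := 2) (by norm_num) (by positivity) hbc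
      rw [Real.logb_mul (by norm_num) (by positivity),
        Real.logb_mul (by positivity) (by positivity), Real.logb_self_eq_one (by norm_num),
        Real.logb_pow] at this
      push_cast at this
      linarith
  have e : ∫ ω, (1 / 2 + 1 / 2 * (Real.logb 2 (D b ω) + Real.logb 2 (D c ω))) ∂μ = _ :=
    integral_add (integrable_const _) (((integrable_of_ae_bounds (f0 b) (f1 b)).add
      (integrable_of_ae_bounds (f0 c) (f1 c))).const_mul _)
  rw [e, integral_const_mul, integral_add (integrable_of_ae_bounds (f0 b) (f1 b))
    (integrable_of_ae_bounds (f0 c) (f1 c))] at key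
  simp only [integral_const, probReal_univ, smul_eq_mul, one_mul] at key
  have : 1 / 2 ≤ Real.logb 2 M * ε := by linarith
  rw [← Real.le_logb_iff_rpow_le (by norm_num) (by linarith)]
  exact (div_le_iff₀ hε).2 this

end Doubling

section AntiConcentration

/-- A quantitative strict concavity of `r ↦ r / (1 + r)`: passing from `a`, `b` to (nearly) `a +
b` gains a definite amount unless `a` is close to `0` or to `∞`. -/
theorem ratio_gain {a b r : ℝ} (ha : 0 < a) (hb : 0 < b) (hr : 9 / 10 * (a + b) ≤ r) :
    1 / 4 * (a / (1 + a) ^ 2) + 1 / 2 * (a / (1 + a)) + 1 / 2 * (b / (1 + b)) ≤ r / (1 + r) := by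
  set s := 9 / 10 * (a + b) with hs
  have s0 : 0 < s := by positivity
  have h1 : s / (1 + s) ≤ r / (1 + r) := by
    rw [div_le_div_iff₀ (by linarith) (by linarith)]; nlinarith
  refine le_trans ?_ h1
  rw [← sub_nonneg]
  have : s / (1 + s) - (1 / 4 * (a / (1 + a) ^ 2) + 1 / 2 * (a / (1 + a)) + 1 / 2 * (b / (1 + b)))
      = (4 * s * (1 + a) ^ 2 * (1 + b) -
        (a * (1 + s) * (1 + b) + 2 * a * (1 + a) * (1 + s) * (1 + b)
        + 2 * b * (1 + a) ^ 2 * (1 + s))) / (4 * (1 + s) * (1 + a) ^ 2 * (1 + b)) := by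
    field_simp
    ring
  rw [this]
  refine div_nonneg ?_ (by positivity)
  rw [hs]
  have := mul_pos ha hb
  have := mul_pos this ha
  have := mul_pos (mul_pos ha hb) hb
  have := pow_pos ha 2
  have := pow_pos hb 2
  have := pow_pos ha 3
  nlinarith [mul_nonneg ha.le (sq_nonneg (a - b)), mul_nonneg hb.le (sq_nonneg (a - b))]

variable {Ω ι : Type*} [MeasurableSpace Ω] [DiscreteMeasurableSpace Ω] {μ : Measure Ω}
  [IsProbabilityMeasure μ] {ε : ℝ}

/-- Anti-concentration: a positive random ratio that nearly dominates the sum of two copies of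
itself is very small or very large, except with probability `O(ε)`. -/
theorem NearLaw.measureReal_ratio_le {R : ι → Ω → ℝ} (h : NearLaw μ ε R)
    (hpos : ∀ i, ∀ᵐ ω ∂μ, 0 < R i ω) (a b c : ι)
    (hsum : ∀ᵐ ω ∂μ, 9 / 10 * (R b ω + R c ω) ≤ R a ω) {K : ℝ} (hK : 1 ≤ K) (i : ι) :
    μ.real {ω | 1 / K < R i ω ∧ R i ω < K} ≤ (16 * K + 1) * ε := by
  have f0 : ∀ i, ∀ᵐ ω ∂μ, 0 ≤ R i ω / (1 + R i ω) := fun i => by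
    filter_upwards [hpos i] with ω p using by positivity
  have f1 : ∀ i, ∀ᵐ ω ∂μ, R i ω / (1 + R i ω) ≤ 1 := fun i => by
    filter_upwards [hpos i] with ω p
    rw [div_le_one (by linarith)]; linarith
  have g0 : ∀ᵐ ω ∂μ, 0 ≤ R b ω / (1 + R b ω) ^ 2 := by
    filter_upwards [hpos b] with ω p using by positivity
  have g1 : ∀ᵐ ω ∂μ, R b ω / (1 + R b ω) ^ 2 ≤ 1 := by
    filter_upwards [hpos b] with ω p
    rw [div_le_one (by positivity)]; nlinarith
  have I := fun i => integrable_of_ae_bounds (f0 i) (f1 i)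
  have J := integrable_of_ae_bounds g0 g1
  have iab := h.integral_le (fun r => r / (1 + r)) zero_le_one f0 f1 a b
  have iac := h.integral_le (fun r => r / (1 + r)) zero_le_one f0 f1 a c
  have key : ∫ ω, (1 / 4 * (R b ω / (1 + R b ω) ^ 2) + 1 / 2 * (R b ω / (1 + R b ω))
      + 1 / 2 * (R c ω / (1 + R c ω))) ∂μ ≤ ∫ ω, R a ω / (1 + R a ω) ∂μ := by
    refine integral_mono_ae (((J.const_mul _).add ((I b).const_mul _)).add
      ((I c).const_mul _)) (I a) ?_
    filter_upwards [hpos b, hpos c, hsum] with ω p q s using ratio_gain p q s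
  have e : ∫ ω, (1 / 4 * (R b ω / (1 + R b ω) ^ 2) + 1 / 2 * (R b ω / (1 + R b ω))
      + 1 / 2 * (R c ω / (1 + R c ω))) ∂μ = _ :=
    integral_add ((J.const_mul _).add ((I b).const_mul _)) ((I c).const_mul _)
  rw [e, integral_add (J.const_mul _) ((I b).const_mul _), integral_const_mul, integral_const_mul,
    integral_const_mul] at key
  have hJ : ∫ ω, R b ω / (1 + R b ω) ^ 2 ∂μ ≤ 4 * ε := by linarith
  -- Markov's inequality, as the integrand is at least `1 / (4 * K)` for ratios in `(1 / K, K)`.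
  have hmk : 1 / (4 * K) * μ.real {ω | 1 / (4 * K) ≤ R b ω / (1 + R b ω) ^ 2} ≤
      ∫ ω, R b ω / (1 + R b ω) ^ 2 ∂μ := mul_meas_ge_le_integral_of_nonneg g0 J _
  have hb : μ.real {ω | 1 / K < R b ω ∧ R b ω < K} ≤ 16 * K * ε := by
    calc _ ≤ μ.real {ω | 1 / (4 * K) ≤ R b ω / (1 + R b ω) ^ 2} := by
          refine measureReal_mono ?_
          rintro ω ⟨p, q⟩
          have r0 : 0 < R b ω := lt_trans (by positivity) p
          rw [div_lt_iff₀ (by linarith)] at p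
          change 1 / (4 * K) ≤ _
          rw [div_le_div_iff₀ (by positivity) (by positivity)]
          nlinarith
      _ ≤ _ := by
          have := hmk.trans hJ
          rw [one_div_mul_eq_div, div_le_iff₀ (by positivity)] at this
          linarith
  have := h i b {r | 1 / K < r ∧ r < K}
  simp only [Set.preimage_ofPred_eq] at this
  linarith

theorem ratio_sum_le {D₁ D₂ D₃ F₁ F₂ F₃ : ℝ} (h1 : 0 < D₁) (hF2 : 0 < F₂) (hF3 : 0 < F₃)
    (h2 : D₁ ≤ 21 / 20 * D₂) (h3 : D₁ ≤ 21 / 20 * D₃) (hF : 19 / 20 * (F₂ + F₃) ≤ F₁) :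
    9 / 10 * (F₂ / D₂ + F₃ / D₃) ≤ F₁ / D₁ := by
  have a : F₂ / D₂ ≤ F₂ / (20 / 21 * D₁) :=
    div_le_div_of_nonneg_left hF2.le (by positivity) (by linarith)
  have b : F₃ / D₃ ≤ F₃ / (20 / 21 * D₁) :=
    div_le_div_of_nonneg_left hF3.le (by positivity) (by linarith)
  have c : F₂ / (20 / 21 * D₁) + F₃ / (20 / 21 * D₁) = 21 / 20 * (F₂ + F₃) / D₁ := by
    field_simp
  have d : 9 / 10 * (21 / 20 * (F₂ + F₃) / D₁) ≤ F₁ / D₁ := by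
    rw [← mul_div_assoc]
    exact div_le_div_of_nonneg_right (by linarith) h1.le
  linarith

end AntiConcentration

/-! ### Systems of node times -/

section Config

/-- One outcome of the node times: `X i j` is the time of the `j`-th node (counted from `0`) of
player `i`, for `j < n`. The position `pos i j` prescribes the order of the nodes, up to a slack
of `1`; successive nodes of one player are at distance at least `40`, which makes the slack
negligible compared with all gaps; and `T` bounds the differences of times. -/
structure IsConfig {ι : Type*} (n : ℕ) (pos : ι → ℕ → ℕ) (T : ℝ) (X : ι → ℕ → ℝ) : Prop where
  order : ∀ i j i' j', j < n → j' < n → pos i j < pos i' j' → X i j ≤ X i' j' + 1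
  gap : ∀ i j, j + 1 < n → X i j + 40 ≤ X i (j + 1)
  spread : ∀ i j i' j', j < n → j' < n → X i j ≤ X i' j' + T

/-- The gap between the nodes `j` and `j + 1`. -/
def gapAt (v : ℕ → ℝ) (j : ℕ) : ℝ := v (j + 1) - v j

/-- The gap after node `j + 1` is at least `K` times the one before it. -/
def Up (K : ℝ) (v : ℕ → ℝ) (j : ℕ) : Prop := K * gapAt v j ≤ gapAt v (j + 1)

/-- The gap before node `j + 1` is at least `K` times the one after it. -/
def Down (K : ℝ) (v : ℕ → ℝ) (j : ℕ) : Prop := K * gapAt v (j + 1) ≤ gapAt v j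

variable {ι : Type*} {n : ℕ} {pos : ι → ℕ → ℕ} {T K : ℝ} {X : ι → ℕ → ℝ}

theorem IsConfig.le_gapAt (h : IsConfig n pos T X) {i : ι} {j : ℕ} (hj : j + 1 < n) :
    40 ≤ gapAt (X i) j := by
  have := h.gap i j hj
  unfold gapAt
  linarith

/-- A gap that is nested in another one is not much longer. -/
theorem IsConfig.gapAt_le (h : IsConfig n pos T X) {i i' : ι} {j k : ℕ} (hj : j + 1 < n)
    (hk : k + 1 < n) (h1 : pos i' k < pos i j) (h2 : pos i (j + 1) < pos i' (k + 1)) :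
    gapAt (X i) j ≤ 21 / 20 * gapAt (X i') k := by
  have a := h.order i' k i j (by omega) (by omega) h1
  have b := h.order i (j + 1) i' (k + 1) hj hk h2
  have c := h.le_gapAt (i := i') hk
  unfold gapAt at *
  linarith

/-- A gap containing two disjoint ones is not much shorter than their sum. -/
theorem IsConfig.gapAt_add_le (h : IsConfig n pos T X) {a b c : ι} {j : ℕ} (hj : j + 1 < n)
    (h1 : pos a j < pos b j) (h2 : pos b (j + 1) < pos c j) (h3 : pos c (j + 1) < pos a (j + 1)) :
    19 / 20 * (gapAt (X b) j + gapAt (X c) j) ≤ gapAt (X a) j := by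
  have p := h.order a j b j (by omega) (by omega) h1
  have q := h.order b (j + 1) c j (by omega) (by omega) h2
  have r := h.order c (j + 1) a (j + 1) (by omega) (by omega) h3
  have s := h.le_gapAt (i := b) hj
  have t := h.le_gapAt (i := c) hj
  unfold gapAt at *
  linarith

/-- If the first gap of `i` contains that of `i'` and the second gap of `i` is contained in that
of `i'`, then the quotient of successive gaps is (nearly) at most as large for `i` as for `i'`. -/
theorem IsConfig.not_down_of_up (h : IsConfig n pos T X) (hK : 2 ≤ K) {i i' : ι} {j k : ℕ}
    (hj : j + 2 < n) (hk : k + 2 < n) (h1 : pos i j < pos i' k)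
    (h2 : pos i' (k + 1) < pos i (j + 1)) (h3 : pos i (j + 2) < pos i' (k + 2)) :
    Up K (X i) j → ¬ Down K (X i') k := by
  intro u d
  have a := h.gapAt_le (i := i') (i' := i) (j := k) (k := j) (by omega) (by omega) h1 h2
  have b := h.gapAt_le (i := i) (i' := i') (j := j + 1) (k := k + 1) (by omega) (by omega) h2 h3
  have p := h.le_gapAt (i := i) (j := j) (by omega)
  have q := h.le_gapAt (i := i') (j := k + 1) (by omega)
  unfold Up at u
  unfold Down at d
  nlinarith

theorem IsConfig.not_down (h : IsConfig n pos T X) (hK : 2 ≤ K) {i : ι} {j : ℕ}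
    (hj : j + 2 < n) (u : Up K (X i) j) : ¬ Down K (X i) j := by
  intro d
  have p := h.le_gapAt (i := i) (j := j) (by omega)
  have q := h.le_gapAt (i := i) (j := j + 1) (by omega)
  unfold Up at u
  unfold Down at d
  nlinarith

/-- Each of the gaps between the `n` nodes is much longer than the preceding one. -/
def AllUp (K : ℝ) (n : ℕ) (v : ℕ → ℝ) : Prop := ∀ j, j + 2 < n → Up K v j

/-- Each of the gaps between the `n` nodes is much shorter than the preceding one. -/
def AllDown (K : ℝ) (n : ℕ) (v : ℕ → ℝ) : Prop := ∀ j, j + 2 < n → Down K v j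

theorem IsConfig.sub_zero_le_of_allUp (h : IsConfig n pos T X) (hK : 2 ≤ K) {i : ι}
    (u : AllUp K n (X i)) : ∀ j, j + 1 < n → X i (j + 1) - X i 0 ≤ 2 * gapAt (X i) j := by
  intro j
  induction j with
  | zero =>
    intro hj
    have := h.le_gapAt (i := i) hj
    unfold gapAt at *
    simp only [zero_add] at *
    linarith
  | succ j ih =>
    intro hj
    have a := ih (by omega)
    have b := u j hj
    have c := h.le_gapAt (i := i) (j := j) (by omega)
    have e : gapAt (X i) (j + 1) = X i (j + 1 + 1) - X i (j + 1) := rfl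
    unfold Up at b
    nlinarith

theorem IsConfig.last_sub_le_of_allDown (h : IsConfig n pos T X) (hK : 2 ≤ K) {i : ι}
    (u : AllDown K n (X i)) : ∀ d j, j + d + 2 = n → X i (n - 1) - X i j ≤ 2 * gapAt (X i) j := by
  intro d
  induction d with
  | zero =>
    intro j hj
    have := h.le_gapAt (i := i) (j := j) (by omega)
    have e : n - 1 = j + 1 := by omega
    unfold gapAt at *
    rw [e]
    linarith
  | succ d ih =>
    intro j hj
    have a := ih (j + 1) (by omega)
    have b := u j (by omega)
    have c := h.le_gapAt (i := i) (j := j + 1) (by omega)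
    have e : gapAt (X i) j = X i (j + 1) - X i j := rfl
    unfold Down at b
    nlinarith

end Config

section System

variable {Ω ι : Type*} [MeasurableSpace Ω]

/-- A random family of node times whose outcomes respect the positions and whose laws, as vectors
of node times, are the same for all players up to `ε`. -/
structure IsSystem (μ : Measure Ω) (n : ℕ) (pos : ι → ℕ → ℕ) (ε T : ℝ) (x : ι → Ω → ℕ → ℝ) :
    Prop where
  law : NearLaw μ ε x
  config : ∀ᵐ ω ∂μ, IsConfig n pos T fun i => x i ω

/-- Every random family of node times with this arrangement of nodes needs differences of times
that are at least a tower of height `r` in `1 / ε`. Only differences of times matter, so the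
notion is invariant under translations. -/
def IsHard {ι : Type*} (r n : ℕ) (pos : ι → ℕ → ℕ) : Prop :=
  ∃ k ε₀ : ℝ, 0 < k ∧ 0 < ε₀ ∧ ∀ (Ω : Type) [MeasurableSpace Ω] [DiscreteMeasurableSpace Ω]
    (μ : Measure Ω) [IsProbabilityMeasure μ] (ε T : ℝ) (x : ι → Ω → ℕ → ℝ),
    0 < ε → ε ≤ ε₀ → IsSystem μ n pos ε T x → expTwoIter r (k / ε) ≤ T

/-- The arrangement of three players in blocks `0 1 1 2 2 0`, where the `k`-th block holds their
nodes `2 k` and `2 k + 1`. Then the gap of player `0` in a block contains the disjoint gaps of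
players `1` and `2`, and between blocks the gap of player `0` is contained in those of the others.
-/
def blockPos : Fin 3 → ℕ → ℕ :=
  ![fun j => 6 * (j / 2) + 5 * (j % 2), fun j => 6 * (j / 2) + 1 + j % 2,
    fun j => 6 * (j / 2) + 3 + j % 2]

theorem isHard_one : IsHard 1 2 blockPos := by
  refine ⟨1 / 2, 1, by norm_num, one_pos, ?_⟩
  intro Ω _ _ μ _ ε T x hε _ h
  change (2 : ℝ) ^ (1 / 2 / ε) ≤ T
  refine (h.law.map fun v => gapAt v 0).two_rpow_le hε (fun i => ?_) (fun i => ?_) 0 1 2 ?_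
  · filter_upwards [h.config] with ω c
    have := c.le_gapAt (i := i) (j := 0) (by norm_num)
    linarith
  · filter_upwards [h.config] with ω c
    have := c.spread i 1 i 0 (by norm_num) (by norm_num)
    simp only [gapAt, zero_add]
    linarith
  · filter_upwards [h.config] with ω c
    have := c.gapAt_add_le (a := 0) (b := 1) (c := 2) (j := 0) (by norm_num) (by decide) (by decide)
      (by decide)
    have p := c.le_gapAt (i := 1) (j := 0) (by norm_num)
    have q := c.le_gapAt (i := 2) (j := 0) (by norm_num)
    linarith

variable [DiscreteMeasurableSpace Ω] {μ : Measure Ω} [IsProbabilityMeasure μ] {n : ℕ}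
  {pos : ι → ℕ → ℕ} {ε T K : ℝ} {x : ι → Ω → ℕ → ℝ}

/-- In the presence of three players arranged by `blockPos`, two successive gaps of any player are
of different orders of magnitude, except with probability `O(ε)`. -/
theorem IsSystem.measureReal_not_up_not_down_le (h : IsSystem μ n pos ε T x) (hK : 1 ≤ K)
    (t : Fin 3 → ι) (ht : ∀ k, pos (t k) = blockPos k) (i : ι) {j : ℕ} (hj : j + 2 < n) :
    μ.real {ω | ¬ Up K (x i ω) j ∧ ¬ Down K (x i ω) j} ≤ (16 * K + 1) * ε := by
  have t0 : ∀ j, pos (t 0) j = 6 * (j / 2) + 5 * (j % 2) := fun j => by rw [ht]; rfl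
  have t1 : ∀ j, pos (t 1) j = 6 * (j / 2) + 1 + j % 2 := fun j => by rw [ht]; rfl
  have t2 : ∀ j, pos (t 2) j = 6 * (j / 2) + 3 + j % 2 := fun j => by rw [ht]; rfl
  rcases Nat.even_or_odd' j with ⟨k, hk | hk⟩
  -- For even `j` the first of the two gaps is the one inside a block, and the quotient is inverted.
  · refine le_trans ?_ ((h.law.map fun v => gapAt v j / gapAt v (j + 1)).measureReal_ratio_le
      (fun i => ?_) (t 0) (t 1) (t 2) ?_ hK i)
    · refine measureReal_le_of_ae ?_
      filter_upwards [h.config] with ω c hω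
      have p := c.le_gapAt (i := i) (j := j) (by omega)
      have q := c.le_gapAt (i := i) (j := j + 1) (by omega)
      obtain ⟨u, d⟩ := hω
      unfold Up at u
      unfold Down at d
      refine ⟨?_, ?_⟩
      · rw [div_lt_div_iff₀ (by linarith) (by linarith)]; linarith
      · rw [div_lt_iff₀ (by linarith)]; linarith
    · filter_upwards [h.config] with ω c
      have p := c.le_gapAt (i := i) (j := j) (by omega)
      have q := c.le_gapAt (i := i) (j := j + 1) (by omega)
      positivity
    · filter_upwards [h.config] with ω c
      have s := c.gapAt_add_le (a := t 0) (b := t 1) (c := t 2) (j := j) (by omega)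
        (by rw [t0, t1]; omega) (by rw [t1, t2]; omega) (by rw [t0, t2]; omega)
      have p1 := c.gapAt_le (i := t 0) (i' := t 1) (j := j + 1) (k := j + 1) (by omega) (by omega)
        (by rw [t0, t1]; omega) (by rw [t0, t1]; omega)
      have p2 := c.gapAt_le (i := t 0) (i' := t 2) (j := j + 1) (k := j + 1) (by omega) (by omega)
        (by rw [t0, t2]; omega) (by rw [t0, t2]; omega)
      exact ratio_sum_le (by linarith [c.le_gapAt (i := t 0) (j := j + 1) (by omega)])
        (by linarith [c.le_gapAt (i := t 1) (j := j) (by omega)])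
        (by linarith [c.le_gapAt (i := t 2) (j := j) (by omega)]) p1 p2 s
  · refine le_trans ?_ ((h.law.map fun v => gapAt v (j + 1) / gapAt v j).measureReal_ratio_le
      (fun i => ?_) (t 0) (t 1) (t 2) ?_ hK i)
    · refine measureReal_le_of_ae ?_
      filter_upwards [h.config] with ω c hω
      have p := c.le_gapAt (i := i) (j := j) (by omega)
      have q := c.le_gapAt (i := i) (j := j + 1) (by omega)
      obtain ⟨u, d⟩ := hω
      unfold Up at u
      unfold Down at d
      refine ⟨?_, ?_⟩
      · rw [div_lt_div_iff₀ (by linarith) (by linarith)]; linarith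
      · rw [div_lt_iff₀ (by linarith)]; linarith
    · filter_upwards [h.config] with ω c
      have p := c.le_gapAt (i := i) (j := j) (by omega)
      have q := c.le_gapAt (i := i) (j := j + 1) (by omega)
      positivity
    · filter_upwards [h.config] with ω c
      have s := c.gapAt_add_le (a := t 0) (b := t 1) (c := t 2) (j := j + 1) (by omega)
        (by rw [t0, t1]; omega) (by rw [t1, t2]; omega) (by rw [t0, t2]; omega)
      have p1 := c.gapAt_le (i := t 0) (i' := t 1) (j := j) (k := j) (by omega) (by omega)
        (by rw [t0, t1]; omega) (by rw [t0, t1]; omega)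
      have p2 := c.gapAt_le (i := t 0) (i' := t 2) (j := j) (k := j) (by omega) (by omega)
        (by rw [t0, t2]; omega) (by rw [t0, t2]; omega)
      exact ratio_sum_le (by linarith [c.le_gapAt (i := t 0) (j := j) (by omega)])
        (by linarith [c.le_gapAt (i := t 1) (j := j + 1) (by omega)])
        (by linarith [c.le_gapAt (i := t 2) (j := j + 1) (by omega)]) p1 p2 s

/-- Conditioning on an event that nearly is, for every `i`, an event about `u i` alone keeps the
laws close to each other. -/
theorem NearLaw.cond {β : Type*} {u : ι → Ω → β} (h : NearLaw μ ε u) {δ : ℝ} (𝒢 : Set β) (G : Set Ω)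
    (hG : ∀ i, G ⊆ u i ⁻¹' 𝒢) (hδ : ∀ i, μ.real (u i ⁻¹' 𝒢 \ G) ≤ δ) (hε : 0 ≤ ε + δ)
    (h4 : 1 / 4 ≤ μ.real G) : NearLaw μ[|G] (4 * (ε + δ)) u := by
  intro i i' S
  have e : ∀ A : Set Ω, (μ[|G]).real A = (μ.real G)⁻¹ * μ.real (G ∩ A) := fun A => by
    rw [measureReal_def, cond_apply (MeasurableSet.of_discrete), ENNReal.toReal_mul,
      ENNReal.toReal_inv]; rfl
  have key : μ.real (G ∩ u i ⁻¹' S) ≤ μ.real (G ∩ u i' ⁻¹' S) + (ε + δ) := by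
    calc _ ≤ μ.real (u i ⁻¹' (S ∩ 𝒢)) := measureReal_mono fun ω hω => ⟨hω.2, hG i hω.1⟩
      _ ≤ μ.real (u i' ⁻¹' (S ∩ 𝒢)) + ε := h i i' _
      _ ≤ μ.real ((G ∩ u i' ⁻¹' S) ∪ (u i' ⁻¹' 𝒢 \ G)) + ε := by
          gcongr
          · simp
          · intro ω hω
            by_cases hg : ω ∈ G
            · exact Or.inl ⟨hg, hω.1⟩
            · exact Or.inr ⟨hω.2, hg⟩
      _ ≤ _ := by
          have := measureReal_union_le (μ := μ) (G ∩ u i' ⁻¹' S) (u i' ⁻¹' 𝒢 \ G)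
          linarith [hδ i']
  rw [e, e]
  have hinv : (μ.real G)⁻¹ ≤ 4 := by
    rw [inv_le_comm₀ (by linarith) (by norm_num)]; linarith
  have := mul_le_mul_of_nonneg_left key (inv_nonneg.2 (measureReal_nonneg (μ := μ) (s := G)))
  nlinarith

end System

/-! ### Which of two successive gaps dominates -/

section Signs

variable {Ω ι : Type*} [MeasurableSpace Ω] {μ : Measure Ω} {n : ℕ} {pos : ι → ℕ → ℕ} {ε T K δ : ℝ}
  {x : ι → Ω → ℕ → ℝ}

/-- The event that `Up` holds at node `j` of player `i`. -/
def upEvent (K : ℝ) (x : ι → Ω → ℕ → ℝ) (i : ι) (j : ℕ) : Set Ω := {ω | Up K (x i ω) j}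

/-- Three players with the repeated pattern `0 2 2 1 1 0`, preceded by node `0` of player `1`, the
nodes of player `1` running one index ahead of those of player `0`. Players `0` and `2`, and
players `1` and `2`, alternate at equal indices, so their quotients of successive gaps can be
compared at equal indices; those of players `0` and `1` can also be compared with indices shifted
by one. -/
def shiftPos : Fin 3 → ℕ → ℕ :=
  ![fun j => 6 * (j / 2) + 2 + 5 * (j % 2), fun j => 6 * (j / 2) + 5 * (j % 2),
    fun j => 6 * (j / 2) + 3 + j % 2]

/-- The laws of the random vectors `x i` differ by at most `δ` and, up to probability `δ`, of two
successive gaps one is at least `K` times the other. -/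
structure HasSigns (μ : Measure Ω) (n : ℕ) (K δ : ℝ) (x : ι → Ω → ℕ → ℝ) : Prop where
  law : NearLaw μ δ x
  mid : ∀ i j, j + 2 < n → μ.real {ω | ¬ Up K (x i ω) j ∧ ¬ Down K (x i ω) j} ≤ δ

theorem HasSigns.upEvent_law (h : HasSigns μ n K δ x) (i i' : ι) (j : ℕ) :
    μ.real (upEvent K x i j) ≤ μ.real (upEvent K x i' j) + δ :=
  h.law i i' {v | Up K v j}

variable [IsProbabilityMeasure μ]

theorem HasSigns.upEvent_diff_le (h : HasSigns μ n K δ x) {i i' : ι} {j k : ℕ} (hk : k + 2 < n)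
    (hrel : ∀ᵐ ω ∂μ, Up K (x i ω) j → ¬ Down K (x i' ω) k) :
    μ.real (upEvent K x i j \ upEvent K x i' k) ≤ δ := by
  refine le_trans (measureReal_le_of_ae ?_) (h.mid i' k hk)
  filter_upwards [hrel] with ω p q using ⟨q.2, p q.1⟩

theorem HasSigns.upEvent_diff_le_symm [DiscreteMeasurableSpace Ω]
    (h : HasSigns μ n K δ x) {i i' : ι} {j : ℕ} (hj : j + 2 < n)
    (hrel : (∀ᵐ ω ∂μ, Up K (x i ω) j → ¬ Down K (x i' ω) j) ∨
      ∀ᵐ ω ∂μ, Up K (x i' ω) j → ¬ Down K (x i ω) j) :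
    μ.real (upEvent K x i j \ upEvent K x i' j) ≤ 2 * δ := by
  have hδ : 0 ≤ δ := measureReal_nonneg.trans (h.mid i j hj)
  rcases hrel with hr | hr
  · linarith [h.upEvent_diff_le hj hr]
  · have := measureReal_diff_le_of_le (h.upEvent_diff_le hj hr) (h.upEvent_law i i' j)
    linarith

/-- With three players arranged by `shiftPos`, started at index `s`, one of the two implications
between `Up` at `j` and `Up` at `j + 1` holds nearly surely for every player. The parity of `j +
s` decides which. -/
theorem HasSigns.upEvent_diff_succ_le [DiscreteMeasurableSpace Ω]
    (h : HasSigns μ n K δ x) (hK : 2 ≤ K)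
    (hc : ∀ᵐ ω ∂μ, IsConfig n pos T fun i => x i ω) (t : Fin 3 → ι) (s : ℕ)
    (ht : ∀ k j, pos (t k) j = shiftPos k (j + s)) {j : ℕ} (hj : j + 3 < n) (i : ι) :
    ((j + s) % 2 = 0 → μ.real (upEvent K x i j \ upEvent K x i (j + 1)) ≤ 6 * δ) ∧
    ((j + s) % 2 = 1 → μ.real (upEvent K x i (j + 1) \ upEvent K x i j) ≤ 6 * δ) := by
  have tP : ∀ j, pos (t 0) j = 6 * ((j + s) / 2) + 2 + 5 * ((j + s) % 2) := fun j => by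
    rw [ht]; rfl
  have tQ : ∀ j, pos (t 1) j = 6 * ((j + s) / 2) + 5 * ((j + s) % 2) := fun j => by
    rw [ht]; rfl
  have tW : ∀ j, pos (t 2) j = 6 * ((j + s) / 2) + 3 + (j + s) % 2 := fun j => by
    rw [ht]; rfl
  have relP : ∀ j, j + 2 < n → (∀ᵐ ω ∂μ, Up K (x (t 0) ω) j → ¬ Down K (x (t 2) ω) j) ∨
      ∀ᵐ ω ∂μ, Up K (x (t 2) ω) j → ¬ Down K (x (t 0) ω) j := by
    intro j hj
    rcases Nat.mod_two_eq_zero_or_one (j + s) with p | p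
    · left
      filter_upwards [hc] with ω c
      exact c.not_down_of_up hK hj hj (by rw [tP, tW]; omega)
        (by rw [tP, tW]; omega) (by rw [tP, tW]; omega)
    · right
      filter_upwards [hc] with ω c
      exact c.not_down_of_up hK hj hj (by rw [tP, tW]; omega)
        (by rw [tP, tW]; omega) (by rw [tP, tW]; omega)
  have relQ : ∀ j, j + 2 < n → (∀ᵐ ω ∂μ, Up K (x (t 1) ω) j → ¬ Down K (x (t 2) ω) j) ∨
      ∀ᵐ ω ∂μ, Up K (x (t 2) ω) j → ¬ Down K (x (t 1) ω) j := by
    intro j hj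
    rcases Nat.mod_two_eq_zero_or_one (j + s) with p | p
    · left
      filter_upwards [hc] with ω c
      exact c.not_down_of_up hK hj hj (by rw [tQ, tW]; omega)
        (by rw [tQ, tW]; omega) (by rw [tQ, tW]; omega)
    · right
      filter_upwards [hc] with ω c
      exact c.not_down_of_up hK hj hj (by rw [tQ, tW]; omega)
        (by rw [tQ, tW]; omega) (by rw [tQ, tW]; omega)
  have law : ∀ a b, NearLaw μ δ x → μ.real (upEvent K x i a \ upEvent K x i b) ≤
      μ.real (upEvent K x (t 2) a \ upEvent K x (t 2) b) + δ := fun a b hl =>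
    hl i (t 2) {v | Up K v a ∧ ¬ Up K v b}
  constructor
  · intro p
    have hr : ∀ᵐ ω ∂μ, Up K (x (t 0) ω) j → ¬ Down K (x (t 1) ω) (j + 1) := by
      filter_upwards [hc] with ω c
      exact c.not_down_of_up hK (by omega) (by omega) (by rw [tP, tQ]; omega)
        (by rw [tP, tQ]; omega) (by rw [tP, tQ]; omega)
    have a := h.upEvent_diff_le_symm (by omega) (relP j (by omega)).symm
    have b := h.upEvent_diff_le (by omega) hr
    have c := h.upEvent_diff_le_symm (by omega) (relQ (j + 1) (by omega))
    have d := measureReal_diff_le_add (μ := μ) (upEvent K x (t 2) j) (upEvent K x (t 0) j)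
      (upEvent K x (t 2) (j + 1))
    have e := measureReal_diff_le_add (μ := μ) (upEvent K x (t 0) j) (upEvent K x (t 1) (j + 1))
      (upEvent K x (t 2) (j + 1))
    linarith [law j (j + 1) h.law]
  · intro p
    have hr : ∀ᵐ ω ∂μ, Up K (x (t 1) ω) (j + 1) → ¬ Down K (x (t 0) ω) j := by
      filter_upwards [hc] with ω c
      exact c.not_down_of_up hK (by omega) (by omega) (by rw [tP, tQ]; omega)
        (by rw [tP, tQ]; omega) (by rw [tP, tQ]; omega)
    have a := h.upEvent_diff_le_symm (by omega) (relP j (by omega))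
    have b := h.upEvent_diff_le (by omega) hr
    have c := h.upEvent_diff_le_symm (by omega) (relQ (j + 1) (by omega)).symm
    have d := measureReal_diff_le_add (μ := μ) (upEvent K x (t 2) (j + 1))
      (upEvent K x (t 1) (j + 1)) (upEvent K x (t 2) j)
    have e := measureReal_diff_le_add (μ := μ) (upEvent K x (t 1) (j + 1)) (upEvent K x (t 0) j)
      (upEvent K x (t 2) j)
    linarith [law (j + 1) j h.law]

/-- Nearly surely, the direction in which successive gaps of a player compare is the same at all
nodes. -/
structure HasSteadySigns (μ : Measure Ω) (n : ℕ) (K δ : ℝ) (x : ι → Ω → ℕ → ℝ) : Prop extends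
    HasSigns μ n K δ x where
  succ : ∀ i j, j + 3 < n → μ.real (upEvent K x i j \ upEvent K x i (j + 1)) ≤ 6 * δ
  pred : ∀ i j, j + 3 < n → μ.real (upEvent K x i (j + 1) \ upEvent K x i j) ≤ 6 * δ

theorem HasSteadySigns.upEvent_diff_allUp_le (h : HasSteadySigns μ n K δ x) (i : ι) :
    μ.real (upEvent K x i 0 \ {ω | AllUp K n (x i ω)}) ≤ 6 * n * δ := by
  have main : ∀ m, m + 2 < n → μ.real (upEvent K x i 0 \ {ω | ∀ j, j ≤ m → Up K (x i ω) j}) ≤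
      6 * m * δ := by
    intro m
    induction m with
    | zero =>
      intro _
      have : upEvent K x i 0 \ {ω | ∀ j, j ≤ 0 → Up K (x i ω) j} = ∅ := by
        ext ω
        simp [upEvent]
      rw [this]
      simp
    | succ m ih =>
      intro hm
      have a := ih (by omega)
      have b := h.succ i m hm
      have : upEvent K x i 0 \ {ω | ∀ j, j ≤ m + 1 → Up K (x i ω) j} ⊆
          (upEvent K x i 0 \ {ω | ∀ j, j ≤ m → Up K (x i ω) j}) ∪
          (upEvent K x i m \ upEvent K x i (m + 1)) := by
        rintro ω ⟨p, q⟩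
        by_cases r : ∀ j, j ≤ m → Up K (x i ω) j
        · refine Or.inr ⟨r m le_rfl, fun s => q ?_⟩
          intro j hj
          rcases Nat.lt_or_ge j (m + 1) with t | t
          · exact r j (by omega)
          · obtain rfl : j = m + 1 := by omega
            exact s
        · exact Or.inl ⟨p, r⟩
      have c := (measureReal_mono this).trans (measureReal_union_le (μ := μ) _ _)
      push_cast
      linarith
  rcases Nat.lt_or_ge 2 n with hn | hn
  · have := main (n - 3) (by omega)
    have hδ : 0 ≤ δ := measureReal_nonneg.trans (h.mid i 0 (by omega))
    refine (measureReal_mono ?_).trans (this.trans ?_)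
    · rintro ω ⟨p, q⟩
      exact ⟨p, fun r => q fun j hj => r j (by omega)⟩
    · have : ((n - 3 : ℕ) : ℝ) ≤ n := by exact_mod_cast Nat.sub_le _ _
      gcongr
  · have hδ : 0 ≤ δ := by
      have := h.law i i ∅
      simpa using this
    have : upEvent K x i 0 \ {ω | AllUp K n (x i ω)} = ∅ := by
      ext ω
      simp only [Set.mem_sdiff, Set.mem_empty_iff_false, iff_false, not_and, not_not]
      intro _ j hj
      omega
    rw [this]
    simp only [measureReal_empty]
    positivity

theorem HasSteadySigns.compl_upEvent_diff_allDown_le (h : HasSteadySigns μ n K δ x) (i : ι)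
    (hn : 2 < n) :
    μ.real ((upEvent K x i 0)ᶜ \ {ω | AllDown K n (x i ω)}) ≤ 7 * n * δ := by
  have hδ : 0 ≤ δ := measureReal_nonneg.trans (h.mid i 0 (by omega))
  have main : ∀ m, m + 2 < n → μ.real ((upEvent K x i 0)ᶜ \
      {ω | ¬ Up K (x i ω) m ∧ ∀ j, j ≤ m → Down K (x i ω) j}) ≤ 7 * (m + 1) * δ := by
    intro m
    induction m with
    | zero =>
      intro _
      refine (measureReal_mono ?_).trans ((h.mid i 0 (by omega)).trans (by norm_num; linarith))
      rintro ω ⟨p, q⟩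
      refine ⟨p, fun r => q ⟨p, fun j hj => ?_⟩⟩
      obtain rfl : j = 0 := by omega
      exact r
    | succ m ih =>
      intro hm
      have a := ih (by omega)
      have b := h.pred i m hm
      have b' := h.mid i (m + 1) (by omega)
      have : (upEvent K x i 0)ᶜ \
          {ω | ¬ Up K (x i ω) (m + 1) ∧ ∀ j, j ≤ m + 1 → Down K (x i ω) j} ⊆
          ((upEvent K x i 0)ᶜ \ {ω | ¬ Up K (x i ω) m ∧ ∀ j, j ≤ m → Down K (x i ω) j}) ∪
          ((upEvent K x i (m + 1) \ upEvent K x i m) ∪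
            {ω | ¬ Up K (x i ω) (m + 1) ∧ ¬ Down K (x i ω) (m + 1)}) := by
        rintro ω ⟨p, q⟩
        by_cases r : ¬ Up K (x i ω) m ∧ ∀ j, j ≤ m → Down K (x i ω) j
        · right
          by_cases s : Up K (x i ω) (m + 1)
          · exact Or.inl ⟨s, r.1⟩
          · refine Or.inr ⟨s, fun s' => q ⟨s, fun j hj => ?_⟩⟩
            rcases Nat.lt_or_ge j (m + 1) with t | t
            · exact r.2 j (by omega)
            · obtain rfl : j = m + 1 := by omega
              exact s'
        · exact Or.inl ⟨p, r⟩
      have c := (measureReal_mono this).trans (measureReal_union_le (μ := μ) _ _)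
      have d := measureReal_union_le (μ := μ) (upEvent K x i (m + 1) \ upEvent K x i m)
        {ω | ¬ Up K (x i ω) (m + 1) ∧ ¬ Down K (x i ω) (m + 1)}
      push_cast
      linarith
  have := main (n - 3) (by omega)
  refine (measureReal_mono ?_).trans (this.trans ?_)
  · rintro ω ⟨p, q⟩
    exact ⟨p, fun r => q fun j hj => r.2 j (by omega)⟩
  · have : ((n - 3 : ℕ) : ℝ) + 1 ≤ n := by
      have : n - 3 + 1 ≤ n := by omega
      exact_mod_cast this
    gcongr

end Signs

/-! ### A common direction, and the passage to logarithms -/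

section CommonSign

variable {Ω ι κ : Type*} [MeasurableSpace Ω] {μ : Measure Ω} {n : ℕ}
  {pos : ι → ℕ → ℕ} {ε T K δ : ℝ} {x : ι → Ω → ℕ → ℝ}

theorem measureReal_diff_iInter_le [Fintype κ] {A : κ → Set Ω} {η : ℝ}
    (hA : ∀ k k', μ.real (A k \ A k') ≤ η) (k : κ) :
    μ.real (A k \ ⋂ k', A k') ≤ Fintype.card κ * η := by
  rw [Set.sdiff_iInter]
  refine (measureReal_iUnion_fintype_le _).trans ?_
  refine (Finset.sum_le_sum fun k' _ => hA k k').trans ?_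
  simp

variable [IsProbabilityMeasure μ]

/-- If the first gap of `i` lies in that of `a`, and the second gap of `a` ends before the last
node of `i`, then an increase at the start of `a` excludes a decrease throughout `i`. -/
theorem IsConfig.not_allDown_of_up {X : ι → ℕ → ℝ} (h : IsConfig n pos T X) (hK : 4 ≤ K)
    (hn : 2 < n) {a i : ι} (h0 : pos a 0 < pos i 0) (h1 : pos i 1 < pos a 1)
    (h2 : pos a 2 < pos i (n - 1)) (u : Up K (X a) 0) : ¬ AllDown K n (X i) := by
  intro d
  have p := h.gapAt_le (i := i) (i' := a) (j := 0) (k := 0) (by omega) (by omega) h0 h1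
  have q := h.last_sub_le_of_allDown (by linarith) d (n - 3) 1 (by omega)
  have r := d 0 (by omega)
  have s := h.order a 2 i (n - 1) hn (by omega) h2
  have t := h.order i 1 a 1 (by omega) (by omega) h1
  have v := h.le_gapAt (i := a) (j := 0) (by omega)
  have w := h.le_gapAt (i := i) (j := 1) (by omega)
  have e : gapAt (X a) 1 = X a 2 - X a 1 := rfl
  unfold Up at u
  unfold Down at r
  simp only [zero_add] at u r
  nlinarith

/-- Given a player `a` comparable with all the players `e k`, these players have nearly surely a
common direction. One of the two directions has probability at least `1 / 4`. -/
theorem HasSteadySigns.exists_event [DiscreteMeasurableSpace Ω] [Fintype κ] [Nonempty κ]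
    (h : HasSteadySigns μ n K δ x)
    (hc : ∀ᵐ ω ∂μ, IsConfig n pos T fun i => x i ω) (hK : 4 ≤ K) (hn : 2 < n) (a : ι) (e : κ → ι)
    (h0 : ∀ k, pos a 0 < pos (e k) 0) (h1 : ∀ k, pos (e k) 1 < pos a 1)
    (h2 : ∀ k, pos a 2 < pos (e k) (n - 1)) (hδ : Fintype.card κ * (25 * n * δ) ≤ 1 / 6) :
    ∃ 𝒢 : Set (ℕ → ℝ), (𝒢 = {v | AllUp K n v} ∨ 𝒢 = {v | AllDown K n v}) ∧
      ∃ G : Set Ω, (∀ k, G ⊆ x (e k) ⁻¹' 𝒢) ∧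
        (∀ k, μ.real (x (e k) ⁻¹' 𝒢 \ G) ≤ Fintype.card κ * (25 * n * δ)) ∧ 1 / 4 ≤ μ.real G := by
  have hδ0 : 0 ≤ δ := measureReal_nonneg.trans (h.mid a 0 (by omega))
  have hn1 : (1 : ℝ) ≤ n := by exact_mod_cast (by omega : 1 ≤ n)
  have hnδ : δ ≤ n * δ := le_mul_of_one_le_left hδ0 hn1
  have hκ : (1 : ℝ) ≤ Fintype.card κ := by exact_mod_cast Fintype.card_pos
  have hκ' : 25 * n * δ ≤ Fintype.card κ * (25 * n * δ) :=
    le_mul_of_one_le_left (by positivity) hκ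
  set U : κ → Set Ω := fun k => x (e k) ⁻¹' {v | AllUp K n v} with hU
  set D : κ → Set Ω := fun k => x (e k) ⁻¹' {v | AllDown K n v} with hD
  have up_all : ∀ k, μ.real (upEvent K x (e k) 0 \ U k) ≤ 6 * n * δ :=
    fun k => h.upEvent_diff_allUp_le (e k)
  have down_all : ∀ k, μ.real ((upEvent K x (e k) 0)ᶜ \ D k) ≤ 7 * n * δ :=
    fun k => h.compl_upEvent_diff_allDown_le (e k) hn
  have all_up : ∀ k, U k ⊆ upEvent K x (e k) 0 := fun k ω hω => hω 0 (by omega)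
  have all_down : ∀ k, μ.real (D k \ (upEvent K x (e k) 0)ᶜ) ≤ 0 := by
    intro k
    have : μ.real (D k \ (upEvent K x (e k) 0)ᶜ) ≤ μ.real (∅ : Set Ω) := by
      refine measureReal_le_of_ae ?_
      filter_upwards [hc] with ω c p
      simp only [Set.mem_sdiff, Set.mem_compl_iff, not_not] at p
      exact (c.not_down (by linarith) (by omega) p.2) (p.1 0 (by omega))
    simpa using this
  have star1 : ∀ k, μ.real (upEvent K x a 0 \ upEvent K x (e k) 0) ≤ 7 * n * δ := by
    intro k
    refine le_trans (measureReal_le_of_ae ?_) (down_all k)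
    filter_upwards [hc] with ω c p
    exact ⟨p.2, c.not_allDown_of_up hK hn (h0 k) (h1 k) (h2 k) p.1⟩
  have star2 : ∀ k, μ.real (upEvent K x (e k) 0 \ upEvent K x a 0) ≤ 8 * n * δ := by
    intro k
    have := measureReal_diff_le_of_le (star1 k) (h.upEvent_law (e k) a 0)
    linarith
  have UU : ∀ k k', μ.real (U k \ U k') ≤ 25 * n * δ := by
    intro k k'
    have p := measureReal_diff_le_add (μ := μ) (upEvent K x (e k) 0) (upEvent K x a 0) (U k')
    have q := measureReal_diff_le_add (μ := μ) (upEvent K x a 0) (upEvent K x (e k') 0) (U k')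
    have r : μ.real (U k \ U k') ≤ μ.real (upEvent K x (e k) 0 \ U k') :=
      measureReal_mono (Set.sdiff_subset_sdiff_left (all_up k))
    linarith [up_all k', star1 k', star2 k]
  have DD : ∀ k k', μ.real (D k \ D k') ≤ 25 * n * δ := by
    intro k k'
    have p := measureReal_diff_le_add (μ := μ) (D k) (upEvent K x (e k) 0)ᶜ (D k')
    have q := measureReal_diff_le_add (μ := μ) (upEvent K x (e k) 0)ᶜ (upEvent K x a 0)ᶜ (D k')
    have r := measureReal_diff_le_add (μ := μ) (upEvent K x a 0)ᶜ (upEvent K x (e k') 0)ᶜ (D k')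
    rw [compl_sdiff_compl] at q r
    linarith [down_all k', star1 k, star2 k', all_down k]
  have UG := measureReal_diff_iInter_le UU
  have DG := measureReal_diff_iInter_le DD
  have k := Classical.arbitrary κ
  have total : 1 ≤ μ.real (⋂ k, U k) + μ.real (⋂ k, D k) + 3 * (Fintype.card κ * (25 * n * δ)) := by
    have c : (Set.univ : Set Ω) ⊆ ((⋂ k, U k) ∪ (U k \ ⋂ k, U k)) ∪ (((⋂ k, D k) ∪ (D k \ ⋂ k, D k))
        ∪ ((upEvent K x (e k) 0 \ U k) ∪ ((upEvent K x (e k) 0)ᶜ \ D k))) := by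
      intro ω _
      by_cases p : ω ∈ U k
      · by_cases q : ω ∈ ⋂ k, U k
        · exact Or.inl (Or.inl q)
        · exact Or.inl (Or.inr ⟨p, q⟩)
      by_cases p' : ω ∈ D k
      · by_cases q : ω ∈ ⋂ k, D k
        · exact Or.inr (Or.inl (Or.inl q))
        · exact Or.inr (Or.inl (Or.inr ⟨p', q⟩))
      by_cases r : ω ∈ upEvent K x (e k) 0
      · exact Or.inr (Or.inr (Or.inl ⟨r, p⟩))
      · exact Or.inr (Or.inr (Or.inr ⟨r, p'⟩))
    have m := measureReal_mono (μ := μ) c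
    rw [probReal_univ] at m
    have m1 := measureReal_union_le (μ := μ) ((⋂ k, U k) ∪ (U k \ ⋂ k, U k)) (((⋂ k, D k) ∪
      (D k \ ⋂ k, D k)) ∪ ((upEvent K x (e k) 0 \ U k) ∪ ((upEvent K x (e k) 0)ᶜ \ D k)))
    have m2 := measureReal_union_le (μ := μ) (⋂ k, U k) (U k \ ⋂ k, U k)
    have m3 := measureReal_union_le (μ := μ) ((⋂ k, D k) ∪ (D k \ ⋂ k, D k))
      ((upEvent K x (e k) 0 \ U k) ∪ ((upEvent K x (e k) 0)ᶜ \ D k))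
    have m4 := measureReal_union_le (μ := μ) (⋂ k, D k) (D k \ ⋂ k, D k)
    have m5 := measureReal_union_le (μ := μ) (upEvent K x (e k) 0 \ U k)
      ((upEvent K x (e k) 0)ᶜ \ D k)
    linarith [up_all k, down_all k, UG k, DG k]
  rcases le_total (1 / 4) (μ.real (⋂ k, U k)) with g | g
  · exact ⟨_, Or.inl rfl, ⋂ k, U k, fun k => Set.iInter_subset _ k, UG, g⟩
  · exact ⟨_, Or.inr rfl, ⋂ k, D k, fun k => Set.iInter_subset _ k, DG, by linarith⟩

end CommonSign

section Log

variable {ι ι' : Type*} {N : ℕ} {pos : ι → ℕ → ℕ} {pos' : ι' → ℕ → ℕ} {T K : ℝ} {X : ι' → ℕ → ℝ}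

/-- If all gaps grow, the binary logarithms of the distances to the own first node form an outcome
for the arrangement of the intermediate nodes. Player `d` shows that the first nodes are much
closer to each other than to the intermediate ones, so that an inequality between times becomes an
inequality up to a factor `2` between distances. -/
theorem IsConfig.log_up (h : IsConfig (N + 2) pos' T X) (hN : 1 ≤ N) (hK : K = 2 ^ 41) (e : ι → ι')
    (d : ι')
    (hA : ∀ i j i' j', j < N → j' < N → pos i j < pos i' j' →
      pos' (e i) (j + 1) < pos' (e i') (j' + 1))
    (h0 : ∀ i, pos' d 0 < pos' (e i) 0) (h1 : ∀ i, pos' (e i) 0 < pos' d 1)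
    (h2 : ∀ i j, j < N → pos' d 2 < pos' (e i) (j + 1))
    (hu : ∀ i, AllUp K (N + 2) (X (e i))) (hd : Up K (X d) 0) :
    IsConfig N pos (Real.logb 2 T) fun i j => Real.logb 2 (X (e i) (j + 1) - X (e i) 0) := by
  have hK4 : 4 ≤ K := by rw [hK]; norm_num
  have ge : ∀ i j, j < N → 40 ≤ X (e i) (j + 1) - X (e i) 0 := by
    intro i j
    induction j with
    | zero => intro _; linarith [h.gap (e i) 0 (by omega)]
    | succ j ih => intro hj; linarith [h.gap (e i) (j + 1) (by omega), ih (by omega)]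
  refine ⟨?_, ?_, ?_⟩
  · intro i j i' j' hj hj' hlt
    have a := h.order _ _ _ _ (by omega) (by omega) (hA i j i' j' hj hj' hlt)
    have b := h.order d 0 (e i) 0 (by omega) (by omega) (h0 i)
    have c := h.order (e i') 0 d 1 (by omega) (by omega) (h1 i')
    have f := h.order d 2 (e i') (j' + 1) (by omega) (by omega) (h2 i' j' hj')
    have g := h.le_gapAt (i := d) (j := 0) (by omega)
    have e0 : gapAt (X d) 0 = X d 1 - X d 0 := rfl
    have e1 : gapAt (X d) 1 = X d 2 - X d 1 := rfl
    unfold Up at hd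
    simp only [zero_add] at hd
    have : X (e i) (j + 1) - X (e i) 0 ≤ 2 * (X (e i') (j' + 1) - X (e i') 0) := by
      nlinarith [ge i' j' hj', ge i j hj]
    have := Real.logb_le_logb_of_le (b := 2) (by norm_num) (by linarith [ge i j hj]) this
    rw [Real.logb_mul (by norm_num) (by linarith [ge i' j' hj']),
      Real.logb_self_eq_one (by norm_num)] at this
    linarith
  · intro i j hj
    have a := h.sub_zero_le_of_allUp (by linarith) (hu i) j (by omega)
    have b := hu i j (by omega)
    have c := ge i j (by omega)
    have e1 : gapAt (X (e i)) (j + 1) = X (e i) (j + 1 + 1) - X (e i) (j + 1) := rfl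
    unfold Up at b
    have : 2 ^ (40 : ℕ) * (X (e i) (j + 1) - X (e i) 0) ≤ X (e i) (j + 1 + 1) - X (e i) 0 := by
      rw [hK] at b
      linarith
    have := Real.logb_le_logb_of_le (b := 2) (by norm_num) (by positivity) this
    rw [Real.logb_mul (by norm_num) (by linarith), Real.logb_pow,
      Real.logb_self_eq_one (by norm_num)] at this
    norm_num at this
    linarith
  · intro i j i' j' hj hj'
    have a := Real.logb_nonneg (b := 2) (by norm_num) (by linarith [ge i' j' hj'] :
      1 ≤ X (e i') (j' + 1) - X (e i') 0)
    have b := Real.logb_le_logb_of_le (b := 2) (by norm_num) (by linarith [ge i j hj])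
      (by linarith [h.spread (e i) (j + 1) (e i) 0 (by omega) (by omega)] :
        X (e i) (j + 1) - X (e i) 0 ≤ T)
    linarith

/-- If all gaps shrink, the same holds for the distances to the own last node. The minus sign
restores the order of the nodes. -/
theorem IsConfig.log_down (h : IsConfig (N + 2) pos' T X) (hN : 1 ≤ N) (hK : K = 2 ^ 41)
    (e : ι → ι') (d : ι')
    (hA : ∀ i j i' j', j < N → j' < N → pos i j < pos i' j' →
      pos' (e i) (j + 1) < pos' (e i') (j' + 1))
    (h0 : ∀ i, pos' d N < pos' (e i) (N + 1)) (h1 : ∀ i, pos' (e i) (N + 1) < pos' d (N + 1))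
    (h2 : ∀ i j, j < N → pos' (e i) (j + 1) < pos' d (N - 1))
    (hu : ∀ i, AllDown K (N + 2) (X (e i))) (hd : Down K (X d) (N - 1)) :
    IsConfig N pos (Real.logb 2 T) fun i j => -Real.logb 2 (X (e i) (N + 1) - X (e i) (j + 1)) := by
  have hK4 : 4 ≤ K := by rw [hK]; norm_num
  have ge : ∀ i t j, j + 1 + t = N → 40 ≤ X (e i) (N + 1) - X (e i) (j + 1) := by
    intro i t
    induction t with
    | zero =>
      intro j hj
      obtain rfl : N = j + 1 := by omega
      linarith [h.gap (e i) (j + 1) (by omega)]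
    | succ t ih => intro j hj; linarith [h.gap (e i) (j + 1) (by omega), ih (j + 1) (by omega)]
  replace ge : ∀ i j, j < N → 40 ≤ X (e i) (N + 1) - X (e i) (j + 1) :=
    fun i j hj => ge i (N - (j + 1)) j (by omega)
  refine ⟨?_, ?_, ?_⟩
  · intro i j i' j' hj hj' hlt
    have a := h.order _ _ _ _ (by omega) (by omega) (hA i j i' j' hj hj' hlt)
    have b := h.order d N (e i) (N + 1) (by omega) (by omega) (h0 i)
    have c := h.order (e i') (N + 1) d (N + 1) (by omega) (by omega) (h1 i')
    have f := h.order (e i) (j + 1) d (N - 1) (by omega) (by omega) (h2 i j hj)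
    have g := h.le_gapAt (i := d) (j := N) (by omega)
    have e0 : gapAt (X d) N = X d (N + 1) - X d N := rfl
    have e1 : gapAt (X d) (N - 1) = X d N - X d (N - 1) := by
      unfold gapAt
      rw [Nat.sub_add_cancel hN]
    unfold Down at hd
    rw [Nat.sub_add_cancel hN] at hd
    have : X (e i') (N + 1) - X (e i') (j' + 1) ≤ 2 * (X (e i) (N + 1) - X (e i) (j + 1)) := by
      nlinarith [ge i' j' hj', ge i j hj]
    have := Real.logb_le_logb_of_le (b := 2) (by norm_num) (by linarith [ge i' j' hj']) this
    rw [Real.logb_mul (by norm_num) (by linarith [ge i j hj]),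
      Real.logb_self_eq_one (by norm_num)] at this
    linarith
  · intro i j hj
    have a := h.last_sub_le_of_allDown (by linarith) (hu i) (N - (j + 2)) (j + 2) (by omega)
    rw [show N + 2 - 1 = N + 1 by omega] at a
    have b := hu i (j + 1) (by omega)
    have c := ge i (j + 1) (by omega)
    have g := ge i j (by omega)
    have e1 : gapAt (X (e i)) (j + 1) = X (e i) (j + 2) - X (e i) (j + 1) := rfl
    unfold Down at b
    simp only [add_assoc, one_add_one_eq_two] at *
    have : 2 ^ (40 : ℕ) * (X (e i) (N + 1) - X (e i) (j + 2)) ≤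
        X (e i) (N + 1) - X (e i) (j + 1) := by
      rw [hK] at b
      linarith
    have := Real.logb_le_logb_of_le (b := 2) (by norm_num) (by positivity) this
    rw [Real.logb_mul (by norm_num) (by linarith), Real.logb_pow,
      Real.logb_self_eq_one (by norm_num)] at this
    norm_num at this
    linarith
  · intro i j i' j' hj hj'
    have a := Real.logb_nonneg (b := 2) (by norm_num) (by linarith [ge i j hj] :
      1 ≤ X (e i) (N + 1) - X (e i) (j + 1))
    have b := Real.logb_le_logb_of_le (b := 2) (by norm_num) (by linarith [ge i' j' hj'])
      (by linarith [h.spread (e i') (N + 1) (e i') (j' + 1) (by omega) (by omega)] :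
        X (e i') (N + 1) - X (e i') (j' + 1) ≤ T)
    linarith

end Log

/-! ### Raising the height of the tower by one -/

theorem expTwoIter_succ (r : ℕ) (y : ℝ) : expTwoIter (r + 1) y = 2 ^ expTwoIter r y :=
  Function.iterate_succ_apply' _ _ _

theorem expTwoIter_mono (r : ℕ) : Monotone (expTwoIter r) := by
  refine Monotone.iterate (fun a b h => ?_) r
  exact Real.rpow_le_rpow_of_exponent_le (by norm_num) h

section LevelUp

/-- Three auxiliary players. Player `0` starts first and has all its other nodes between the
intermediate nodes and the last nodes of the given players; it serves to compare directions.
Player `1` has the first nodes of the given players in its first gap, and player `2` has their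
last nodes in its last gap. -/
def framePos (N M : ℕ) : Fin 3 → ℕ → ℕ :=
  ![fun j => if j = 0 then 0 else 2 * N + 6 + M + j,
    fun j => if j = 0 then 1 else if j ≤ N then 2 + j else 4 * N + 12 + M,
    fun j => if j ≤ N then N + 3 + M + j else 4 * N + 13 + M]

/-- The given players, with one node added at the start and one at the end. -/
def innerPos {ι : Type*} (N M : ℕ) (pos : ι → ℕ → ℕ) (i : ι) (j : ℕ) : ℕ :=
  if j = 0 then 2 else if j ≤ N then N + 3 + pos i (j - 1) else 4 * N + 12 + M

/-- The given players with an added first and last node, and twelve auxiliary ones: three for the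
anti-concentration of quotients of gaps, two triples for the steadiness of directions, and the
three of `framePos`. -/
def levelPos {ι : Type*} (N M : ℕ) (pos : ι → ℕ → ℕ) :
    ι ⊕ Fin 3 ⊕ Fin 3 ⊕ Fin 3 ⊕ Fin 3 → ℕ → ℕ :=
  Sum.elim (innerPos N M pos) (Sum.elim blockPos (Sum.elim shiftPos
    (Sum.elim (fun k j => shiftPos k (j + 1)) (framePos N M))))

theorem IsSystem.hasSigns {Ω ι : Type*} [MeasurableSpace Ω] [DiscreteMeasurableSpace Ω]
    {μ : Measure Ω} [IsProbabilityMeasure μ] {n : ℕ} {pos : ι → ℕ → ℕ} {ε T K : ℝ}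
    {x : ι → Ω → ℕ → ℝ} (h : IsSystem μ n pos ε T x) (hε : 0 ≤ ε) (hK : 1 ≤ K) (t : Fin 3 → ι)
    (ht : ∀ k, pos (t k) = blockPos k) : HasSigns μ n K ((16 * K + 1) * ε) x where
  law := fun i i' S => (h.law i i' S).trans (by nlinarith)
  mid := fun i _ hj => h.measureReal_not_up_not_down_le hK t ht i hj

/-- One exponential is gained: conditioned on a common direction, the logarithms of distances to
the first, or to the last, node form a system for the original arrangement. -/
theorem isHard_levelPos {ι : Type*} [Fintype ι] {r N M : ℕ} {pos : ι → ℕ → ℕ} (hN : 2 ≤ N)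
    (hM : ∀ i j, j < N → pos i j < M) (h : IsHard r N pos) :
    IsHard (r + 1) (N + 2) (levelPos N M pos) := by
  obtain ⟨k, ε₀, hk, hε₀, H⟩ := h
  -- Distances to the first node grow at least by the factor `K / 2`, so that their logarithms are
  -- at distance at least `40`.
  set K : ℝ := 2 ^ 41 with hK
  have hK4 : 4 ≤ K := by rw [hK]; norm_num
  set c : ℝ := Fintype.card (ι ⊕ Fin 2) * (25 * (N + 2 : ℕ) * (16 * K + 1)) with hcdef
  have hc : 0 < c := by
    have : (0 : ℝ) < Fintype.card (ι ⊕ Fin 2) := by exact_mod_cast Fintype.card_pos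
    positivity
  refine ⟨k / (4 * (1 + c)), min (ε₀ / (4 * (1 + c))) (1 / 6 / c), by positivity,
    by positivity, ?_⟩
  intro Ω _ _ μ _ ε T x hε hle hs
  have hle1 := hle.trans (min_le_left _ _)
  have hle2 := hle.trans (min_le_right _ _)
  rw [le_div_iff₀ (by positivity)] at hle1 hle2
  have signs := hs.hasSigns hε.le (by linarith : 1 ≤ K)
    (fun k => Sum.inr (Sum.inl k)) (fun k => rfl)
  -- The two triples are one index apart, so that for each `j` they give opposite implications.
  have shift0 := fun i j hj => signs.upEvent_diff_succ_le (by linarith) hs.config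
    (fun k => Sum.inr (Sum.inr (Sum.inl k))) 0 (fun k j => rfl) (j := j) hj i
  have shift1 := fun i j hj => signs.upEvent_diff_succ_le (by linarith) hs.config
    (fun k => Sum.inr (Sum.inr (Sum.inr (Sum.inl k)))) 1 (fun k j => rfl) (j := j) hj i
  have steady : HasSteadySigns μ (N + 2) K ((16 * K + 1) * ε) x :=
    { toHasSigns := signs
      succ := fun i j hj => by
        rcases Nat.mod_two_eq_zero_or_one j with p | p
        · exact (shift0 i j hj).1 (by omega)
        · exact (shift1 i j hj).1 (by omega)
      pred := fun i j hj => by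
        rcases Nat.mod_two_eq_zero_or_one j with p | p
        · exact (shift1 i j hj).2 (by omega)
        · exact (shift0 i j hj).2 (by omega) }
  have w0 : ∀ j, levelPos N M pos (Sum.inr (Sum.inr (Sum.inr (Sum.inr 0)))) j =
    if j = 0 then 0 else 2 * N + 6 + M + j := fun _ => rfl
  have w1 : ∀ j, levelPos N M pos (Sum.inr (Sum.inr (Sum.inr (Sum.inr 1)))) j =
    if j = 0 then 1 else if j ≤ N then 2 + j else 4 * N + 12 + M := fun _ => rfl
  have w2 : ∀ j, levelPos N M pos (Sum.inr (Sum.inr (Sum.inr (Sum.inr 2)))) j =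
    if j ≤ N then N + 3 + M + j else 4 * N + 13 + M := fun _ => rfl
  have wi : ∀ i j, levelPos N M pos (Sum.inl i) j =
    if j = 0 then 2 else if j ≤ N then N + 3 + pos i (j - 1) else 4 * N + 12 + M := fun _ _ => rfl
  have wi0 : ∀ i, levelPos N M pos (Sum.inl i) 0 = 2 := fun _ => rfl
  have wiL : ∀ i, levelPos N M pos (Sum.inl i) (N + 1) = 4 * N + 12 + M := fun i => by
    rw [wi]; simp
  have wij : ∀ i j, j < N → levelPos N M pos (Sum.inl i) (j + 1) = N + 3 + pos i j :=
    fun i j hj => by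
    rw [wi, if_neg (by omega), if_pos (by omega)]; rfl
  set e : ι ⊕ Fin 2 → ι ⊕ Fin 3 ⊕ Fin 3 ⊕ Fin 3 ⊕ Fin 3 :=
    Sum.elim Sum.inl fun k => Sum.inr (Sum.inr (Sum.inr (Sum.inr k.succ))) with he
  have e1 : e (Sum.inr 0) = Sum.inr (Sum.inr (Sum.inr (Sum.inr 1))) := rfl
  have e2 : e (Sum.inr 1) = Sum.inr (Sum.inr (Sum.inr (Sum.inr 2))) := rfl
  have small : (Fintype.card (ι ⊕ Fin 2) : ℝ) * (25 * (N + 2 : ℕ) * ((16 * K + 1) * ε)) =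
      ε * c := by
    rw [hcdef]; ring
  obtain ⟨𝒢, h𝒢, G, hG, hGd, hG4⟩ := steady.exists_event hs.config hK4 (by omega)
    (Sum.inr (Sum.inr (Sum.inr (Sum.inr 0)))) e
    (by
      rintro (i | i)
      · rw [w0, show e (Sum.inl i) = Sum.inl i from rfl, wi0]; simp
      · fin_cases i
        · simp only [Fin.zero_eta, e1, w0, w1]; simp
        · simp only [Fin.mk_one, e2, w0, w2]; simp)
    (by
      rintro (i | i)
      · rw [w0, show e (Sum.inl i) = Sum.inl i from rfl, wij i 0 (by omega)]
        have := hM i 0 (by omega)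
        simp; omega
      · fin_cases i
        · simp only [Fin.zero_eta, e1, w0, w1]
          rw [if_neg (by omega), if_pos (by omega), if_neg (by omega)]; omega
        · simp only [Fin.mk_one, e2, w0, w2]
          rw [if_pos (by omega), if_neg (by omega)]; omega)
    (by
      rintro (i | i)
      · rw [w0, show e (Sum.inl i) = Sum.inl i from rfl, show N + 2 - 1 = N + 1 by omega, wiL]
        simp; omega
      · rw [show N + 2 - 1 = N + 1 by omega]
        fin_cases i
        · simp only [Fin.zero_eta, e1, w0, w1]
          rw [if_neg (by omega), if_neg (by omega), if_neg (by omega)]; omega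
        · simp only [Fin.mk_one, e2, w0, w2]
          rw [if_neg (by omega), if_neg (by omega)]; omega)
    (by rw [small]; exact hle2)
  rw [small] at hGd
  have hGpos : μ G ≠ 0 := fun h0 => by
    rw [measureReal_def, h0] at hG4
    norm_num at hG4
  have : IsProbabilityMeasure μ[|G] := cond_isProbabilityMeasure hGpos
  have law : NearLaw μ[|G] (4 * (1 + c) * ε) fun i => x (Sum.inl i) := by
    have := ((hs.law.comp e).cond 𝒢 G hG hGd (by positivity) hG4).comp (Sum.inl : ι → ι ⊕ Fin 2)
    rw [show 4 * (1 + c) * ε = 4 * (ε + ε * c) by ring]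
    exact this
  have config : ∀ᵐ ω ∂μ[|G], IsConfig (N + 2) (levelPos N M pos) T fun i => x i ω :=
    cond_absolutelyContinuous.ae_le hs.config
  have mem : ∀ᵐ ω ∂μ[|G], ω ∈ G := ae_cond_mem MeasurableSet.of_discrete
  obtain ⟨f, hf⟩ : ∃ f : (ℕ → ℝ) → ℕ → ℝ, ∀ᵐ ω ∂μ[|G],
      IsConfig N pos (Real.logb 2 T) fun i => f (x (Sum.inl i) ω) := by
    have hA : ∀ i j i' j', j < N → j' < N → pos i j < pos i' j' →
        levelPos N M pos (Sum.inl i) (j + 1) < levelPos N M pos (Sum.inl i') (j' + 1) := by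
      intro i j i' j' hj hj' hlt
      rw [wij i j hj, wij i' j' hj']
      omega
    rcases h𝒢 with rfl | rfl
    · refine ⟨fun v j => Real.logb 2 (v (j + 1) - v 0), ?_⟩
      filter_upwards [config, mem] with ω cω mω
      refine cω.log_up (by omega) hK Sum.inl (Sum.inr (Sum.inr (Sum.inr (Sum.inr 1)))) hA
        (fun i => ?_) (fun i => ?_) (fun i j hj => ?_) (fun i => hG (Sum.inl i) mω)
        (hG (Sum.inr 0) mω 0 (by omega))
      · rw [wi0, w1]; simp
      · rw [wi0, w1, if_neg (by omega), if_pos (by omega)]; omega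
      · rw [wij i j hj, w1, if_neg (by omega), if_pos (by omega)]; omega
    · refine ⟨fun v j => -Real.logb 2 (v (N + 1) - v (j + 1)), ?_⟩
      filter_upwards [config, mem] with ω cω mω
      refine cω.log_down (by omega) hK Sum.inl (Sum.inr (Sum.inr (Sum.inr (Sum.inr 2)))) hA
        (fun i => ?_) (fun i => ?_) (fun i j hj => ?_) (fun i => hG (Sum.inl i) mω)
        (hG (Sum.inr 1) mω (N - 1) (by omega))
      · rw [wiL, w2, if_pos le_rfl]; omega
      · rw [wiL, w2, if_neg (by omega)]; omega
      · have := hM i j hj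
        rw [wij i j hj, w2, if_pos (by omega)]; omega
  have final := H Ω μ[|G] (4 * (1 + c) * ε) (Real.logb 2 T) (fun i ω => f (x (Sum.inl i) ω))
    (by positivity) (by linarith) ⟨law.map f, hf⟩
  have hT : 0 < T := by
    obtain ⟨ω, cω⟩ := hs.config.exists
    have a := cω.gap (Sum.inr (Sum.inl 0)) 0 (by omega)
    have b := cω.spread (Sum.inr (Sum.inl 0)) 1 (Sum.inr (Sum.inl 0)) 0 (by omega) (by omega)
    simp only [zero_add] at a
    linarith
  rw [expTwoIter_succ, ← Real.le_logb_iff_rpow_le (by norm_num) hT, div_div]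
  exact final

theorem levelPos_lt_succ {ι : Type*} {N M : ℕ} {pos : ι → ℕ → ℕ}
    (hM : ∀ i j, j < N → pos i j < M) (h : ∀ i j, j + 1 < N → pos i j < pos i (j + 1)) :
    ∀ i j, j + 1 < N + 2 → levelPos N M pos i j < levelPos N M pos i (j + 1) := by
  have hb : ∀ k j, blockPos k j < blockPos k (j + 1) := by
    intro k j
    fin_cases k <;> simp only [blockPos, Fin.zero_eta, Fin.mk_one, Fin.reduceFinMk,
      Matrix.cons_val] <;> omega
  have hsh : ∀ k j, shiftPos k j < shiftPos k (j + 1) := by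
    intro k j
    fin_cases k <;> simp only [shiftPos, Fin.zero_eta, Fin.mk_one, Fin.reduceFinMk,
      Matrix.cons_val] <;> omega
  rintro (i | k | k | k | k) j hj
  · change innerPos N M pos i j < innerPos N M pos i (j + 1)
    have a : j - 1 < N → pos i (j - 1) < M := hM i (j - 1)
    have b : j - 1 + 1 < N → pos i (j - 1) < pos i (j - 1 + 1) := h i (j - 1)
    unfold innerPos
    grind
  · exact hb k j
  · exact hsh k j
  · exact hsh k (j + 1)
  · change framePos N M k j < framePos N M k (j + 1)
    fin_cases k
    · change (if j = 0 then 0 else 2 * N + 6 + M + j) <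
        if j + 1 = 0 then 0 else 2 * N + 6 + M + (j + 1)
      grind
    · change (if j = 0 then 1 else if j ≤ N then 2 + j else 4 * N + 12 + M) <
        if j + 1 = 0 then 1 else if j + 1 ≤ N then 2 + (j + 1) else 4 * N + 12 + M
      grind
    · change (if j ≤ N then N + 3 + M + j else 4 * N + 13 + M) <
        if j + 1 ≤ N then N + 3 + M + (j + 1) else 4 * N + 13 + M
      grind

theorem exists_forall_pos_lt {ι : Type*} [Fintype ι] (n : ℕ) (pos : ι → ℕ → ℕ) :
    ∃ M, ∀ i j, j < n → pos i j < M := by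
  refine ⟨(∑ i, ∑ j ∈ Finset.range n, pos i j) + 1, fun i j hj => ?_⟩
  have a := Finset.single_le_sum (f := fun j => pos i j) (fun _ _ => Nat.zero_le _)
    (Finset.mem_range.2 hj)
  have b := Finset.single_le_sum (f := fun i => ∑ j ∈ Finset.range n, pos i j)
    (fun _ _ => Nat.zero_le _) (Finset.mem_univ i)
  omega

theorem exists_isHard (r : ℕ) : ∃ (ι : Type) (_ : Fintype ι) (pos : ι → ℕ → ℕ),
    Fintype.card ι = 12 * r + 3 ∧ (∀ i j, j + 1 < 2 * r + 2 → pos i j < pos i (j + 1)) ∧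
      IsHard (r + 1) (2 * r + 2) pos := by
  induction r with
  | zero => exact ⟨Fin 3, inferInstance, blockPos, rfl, by
      intro i j hj
      obtain rfl : j = 0 := by omega
      revert i
      decide, isHard_one⟩
  | succ r ih =>
    obtain ⟨ι, _, pos, hcard, hpos, hh⟩ := ih
    obtain ⟨M, hM⟩ := exists_forall_pos_lt (2 * r + 2) pos
    refine ⟨_, inferInstance, levelPos (2 * r + 2) M pos, ?_, levelPos_lt_succ hM hpos,
      isHard_levelPos (by omega) hM hh⟩
    simp only [Fintype.card_sum, Fintype.card_fin, hcard]
    omega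

end LevelUp

/-! ### Height two with three nodes per player -/

section HeightTwo

theorem ratio_mul_le {D₁ D₂ D₃ F₁ F₂ F₃ : ℝ} (hD1 : 0 < D₁) (hD2 : 0 < D₂) (hD3 : 0 < D₃)
    (hF2 : 0 < F₂) (hF3 : 0 < F₃)
    (h1 : D₁ ≤ 21 / 20 * D₂) (h2 : F₂ ≤ 21 / 20 * D₃) (h3 : F₃ ≤ 21 / 20 * F₁) :
    F₂ / D₂ * (F₃ / D₃) ≤ 2 * (F₁ / D₁) := by
  have hF1 : 0 < F₁ := by linarith
  have e : F₂ / D₂ * (F₃ / D₃) = (F₂ / D₃) * (F₃ / F₁) * (D₁ / D₂) * (F₁ / D₁) := by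
    field_simp
  rw [e]
  have a : F₂ / D₃ ≤ 21 / 20 := by rwa [div_le_iff₀ hD3]
  have b : F₃ / F₁ ≤ 21 / 20 := by rwa [div_le_iff₀ hF1]
  have c : D₁ / D₂ ≤ 21 / 20 := by rwa [div_le_iff₀ hD2]
  refine mul_le_mul_of_nonneg_right ?_ (by positivity)
  calc _ ≤ (21 / 20 : ℝ) * (21 / 20) * (21 / 20) := by gcongr
    _ ≤ 2 := by norm_num

/-- The doubly exponential analogue of `NearLaw.two_rpow_le`, with a product in place of the sum.
-/
theorem NearLaw.expTwoIter_two_le {Ω ι : Type*} [MeasurableSpace Ω] [DiscreteMeasurableSpace Ω]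
    {μ : Measure Ω} [IsProbabilityMeasure μ] {ε T : ℝ} (hε : 0 < ε) {R : ι → Ω → ℝ}
    (h : NearLaw μ ε R) (h1 : ∀ i, ∀ᵐ ω ∂μ, 16 ≤ R i ω) (hT : ∀ i, ∀ᵐ ω ∂μ, R i ω ≤ T) (a b c : ι)
    (hmul : ∀ᵐ ω ∂μ, R b ω * R c ω ≤ 2 * R a ω) : expTwoIter 2 (1 / 2 / ε) ≤ T := by
  have l16 : Real.logb 2 16 = 4 := by
    rw [show (16 : ℝ) = 2 ^ (4 : ℕ) by norm_num, Real.logb_pow, Real.logb_self_eq_one (by norm_num)]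
    norm_num
  have lower : ∀ i, ∀ᵐ ω ∂μ, 4 ≤ Real.logb 2 (R i ω) := fun i => by
    filter_upwards [h1 i] with ω p
    rw [← l16]
    exact Real.logb_le_logb_of_le (by norm_num) (by norm_num) p
  have key := (h.map (Real.logb 2)).two_rpow_le hε (M := Real.logb 2 T)
    (fun i => by filter_upwards [lower i] with ω p using by linarith)
    (fun i => by
      filter_upwards [h1 i, hT i] with ω p q
      exact Real.logb_le_logb_of_le (by norm_num) (by linarith) q) a b c
    (by
      filter_upwards [h1 a, h1 b, h1 c, hmul, lower b, lower c] with ω pa pb pc q lb lc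
      have := Real.logb_le_logb_of_le (b := 2) (by norm_num)
        (mul_pos (by linarith) (by linarith)) q
      rw [Real.logb_mul (by linarith) (by linarith), Real.logb_mul (by norm_num) (by linarith),
        Real.logb_self_eq_one (by norm_num)] at this
      linarith)
  have hT0 : 0 < T := by
    obtain ⟨ω, p, q⟩ := ((h1 a).and (hT a)).exists
    linarith
  change (2 : ℝ) ^ ((2 : ℝ) ^ (1 / 2 / ε)) ≤ T
  rwa [← Real.le_logb_iff_rpow_le (by norm_num) hT0]

/-- The gaps of the three players satisfy: the first of `0` lies in the first of `1`, the second
of `1` in the first of `2`, and the second of `2` in the second of `0`. Hence the quotient of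
successive gaps of `0` is at least the product of those of `1` and `2`. -/
def upPos : Fin 3 → ℕ → ℕ :=
  ![fun j => [2, 3, 8].getD j 0, fun j => [1, 4, 5].getD j 0, fun j => [0, 6, 7].getD j 0]

/-- The reflection of `upPos` in time, with inverted quotients. -/
def downPos : Fin 3 → ℕ → ℕ :=
  ![fun j => [0, 5, 6].getD j 0, fun j => [3, 4, 7].getD j 0, fun j => [1, 2, 8].getD j 0]

/-- Nine players with three nodes each. Raising the height by `levelPos` would cost a fourth node.
-/
def twoPos : Fin 3 ⊕ Fin 3 ⊕ Fin 3 → ℕ → ℕ := Sum.elim blockPos (Sum.elim upPos downPos)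

theorem twoPos_lt_succ : ∀ i j, j + 1 < 3 → twoPos i j < twoPos i (j + 1) := by
  have : ∀ i, ∀ j < 2, twoPos i j < twoPos i (j + 1) := by decide
  exact fun i j hj => this i j (by omega)

/-- Players that are comparable with one of them nearly surely agree in direction. -/
theorem HasSigns.upEvent_diff_le_of_zero {Ω ι : Type*} [MeasurableSpace Ω]
    [DiscreteMeasurableSpace Ω] {μ : Measure Ω} [IsProbabilityMeasure μ] {n : ℕ} {K δ : ℝ}
    {x : ι → Ω → ℕ → ℝ} (h : HasSigns μ n K δ x) (hn : 2 < n) (t : Fin 3 → ι)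
    (hrel : ∀ k, k ≠ 0 → ((∀ᵐ ω ∂μ, Up K (x (t 0) ω) 0 → ¬ Down K (x (t k) ω) 0) ∨
      ∀ᵐ ω ∂μ, Up K (x (t k) ω) 0 → ¬ Down K (x (t 0) ω) 0)) (k k' : Fin 3) :
    μ.real (upEvent K x (t k) 0 \ upEvent K x (t k') 0) ≤ 4 * δ := by
  have hδ : 0 ≤ δ := measureReal_nonneg.trans (h.mid (t 0) 0 (by omega))
  have a : ∀ k, μ.real (upEvent K x (t 0) 0 \ upEvent K x (t k) 0) ≤ 2 * δ := fun k => by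
    by_cases hk : k = 0
    · subst hk
      simpa using hδ
    · exact h.upEvent_diff_le_symm (by omega) (hrel k hk)
  have b : ∀ k, μ.real (upEvent K x (t k) 0 \ upEvent K x (t 0) 0) ≤ 2 * δ := fun k => by
    by_cases hk : k = 0
    · subst hk
      simpa using hδ
    · exact h.upEvent_diff_le_symm (by omega) (hrel k hk).symm
  linarith [a k', b k, measureReal_diff_le_add (μ := μ) (upEvent K x (t k) 0)
    (upEvent K x (t 0) 0) (upEvent K x (t k') 0)]

/-- The quotients of successive gaps play the role of the gaps themselves: either they or their
inverses are large for all players of one triple, with probability at least `1 / 4`. -/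
theorem isHard_two : IsHard 2 3 twoPos := by
  set K : ℝ := 2 ^ 41 with hK
  have hK16 : 16 ≤ K := by rw [hK]; norm_num
  set c : ℝ := 16 * K + 1 with hcdef
  have hc : 0 < c := by positivity
  refine ⟨1 / 2 / (4 * (1 + 15 * c)), 1 / 64 / c, by positivity, by positivity, ?_⟩
  intro Ω _ _ μ _ ε T x hε hle hs
  rw [le_div_iff₀ (by positivity)] at hle
  have signs := hs.hasSigns hε.le (by linarith : 1 ≤ K) Sum.inl (fun k => rfl)
  set u : Fin 3 → Fin 3 ⊕ Fin 3 ⊕ Fin 3 := fun k => Sum.inr (Sum.inl k) with hu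
  set d : Fin 3 → Fin 3 ⊕ Fin 3 ⊕ Fin 3 := fun k => Sum.inr (Sum.inr k) with hd
  have hδ0 : 0 ≤ c * ε := by positivity
  have UU : ∀ k k', μ.real (upEvent K x (u k) 0 \ upEvent K x (u k') 0) ≤ 4 * (c * ε) := by
    refine signs.upEvent_diff_le_of_zero (by norm_num) u fun k hk => Or.inr ?_
    filter_upwards [hs.config] with ω cω
    refine cω.not_down_of_up (by linarith) (by norm_num) (by norm_num) ?_ ?_ ?_ <;>
      revert k <;> decide
  have DD : ∀ k k', μ.real (upEvent K x (d k) 0 \ upEvent K x (d k') 0) ≤ 4 * (c * ε) := by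
    refine signs.upEvent_diff_le_of_zero (by norm_num) d fun k hk => Or.inl ?_
    filter_upwards [hs.config] with ω cω
    refine cω.not_down_of_up (by linarith) (by norm_num) (by norm_num) ?_ ?_ ?_ <;>
      revert k <;> decide
  set B : Fin 3 → Set Ω := fun k => x (d k) ⁻¹' {v | Down K v 0} with hB
  have BB : ∀ k k', μ.real (B k \ B k') ≤ 5 * (c * ε) := by
    intro k k'
    have p : μ.real (B k \ B k') ≤ μ.real ((upEvent K x (d k') 0 \ upEvent K x (d k) 0) ∪
        {ω | ¬ Up K (x (d k') ω) 0 ∧ ¬ Down K (x (d k') ω) 0}) := by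
      refine measureReal_le_of_ae ?_
      filter_upwards [hs.config] with ω cω q
      by_cases r : Up K (x (d k') ω) 0
      · exact Or.inl ⟨r, fun s => cω.not_down (i := d k) (by linarith) (by norm_num) s q.1⟩
      · exact Or.inr ⟨r, q.2⟩
    linarith [measureReal_union_le (μ := μ) (upEvent K x (d k') 0 \ upEvent K x (d k) 0)
        {ω | ¬ Up K (x (d k') ω) 0 ∧ ¬ Down K (x (d k') ω) 0}, DD k' k,
        signs.mid (d k') 0 (by norm_num)]
  set A : Fin 3 → Set Ω := fun k => x (u k) ⁻¹' {v | Up K v 0} with hA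
  have AG : ∀ k, μ.real (A k \ ⋂ k, A k) ≤ 15 * (c * ε) := fun k => by
    have := measureReal_diff_iInter_le UU k
    rw [Fintype.card_fin] at this
    refine this.trans ?_
    push_cast
    linarith
  have BG : ∀ k, μ.real (B k \ ⋂ k, B k) ≤ 15 * (c * ε) := fun k => by
    have := measureReal_diff_iInter_le BB k
    rw [Fintype.card_fin] at this
    refine this.trans ?_
    push_cast
    linarith
  have total : 1 ≤ μ.real (⋂ k, A k) + μ.real (⋂ k, B k) + 30 * (c * ε) + 2 * (c * ε) := by
    have hl := signs.law (d 0) (u 0) {v | Up K v 0}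
    have cv : (Set.univ : Set Ω) ⊆ x (d 0) ⁻¹' {v | Up K v 0} ∪ (((⋂ k, B k) ∪ (B 0 \ ⋂ k, B k)) ∪
        {ω | ¬ Up K (x (d 0) ω) 0 ∧ ¬ Down K (x (d 0) ω) 0}) := by
      intro ω _
      by_cases r : Up K (x (d 0) ω) 0
      · exact Or.inl r
      by_cases s : Down K (x (d 0) ω) 0
      · by_cases q : ω ∈ ⋂ k, B k
        · exact Or.inr (Or.inl (Or.inl q))
        · exact Or.inr (Or.inl (Or.inr ⟨s, q⟩))
      · exact Or.inr (Or.inr ⟨r, s⟩)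
    have av : A 0 ⊆ (⋂ k, A k) ∪ (A 0 \ ⋂ k, A k) := fun ω p => by
      by_cases q : ω ∈ ⋂ k, A k
      · exact Or.inl q
      · exact Or.inr ⟨p, q⟩
    have m := measureReal_mono (μ := μ) cv
    rw [probReal_univ] at m
    have m1 := measureReal_union_le (μ := μ) (x (d 0) ⁻¹' {v | Up K v 0})
      (((⋂ k, B k) ∪ (B 0 \ ⋂ k, B k)) ∪ {ω | ¬ Up K (x (d 0) ω) 0 ∧ ¬ Down K (x (d 0) ω) 0})
    have m2 := measureReal_union_le (μ := μ) ((⋂ k, B k) ∪ (B 0 \ ⋂ k, B k))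
      {ω | ¬ Up K (x (d 0) ω) 0 ∧ ¬ Down K (x (d 0) ω) 0}
    have m3 := measureReal_union_le (μ := μ) (⋂ k, B k) (B 0 \ ⋂ k, B k)
    have m4 := (measureReal_mono av).trans (measureReal_union_le (μ := μ) _ _)
    linarith [AG 0, BG 0, signs.mid (d 0) 0 (by norm_num)]
  have size : ∀ ω, IsConfig 3 twoPos T (fun i => x i ω) → ∀ i j, j < 2 →
      40 ≤ gapAt (x i ω) j ∧ gapAt (x i ω) j ≤ T := by
    intro ω cω i j hj
    refine ⟨cω.le_gapAt (by omega), ?_⟩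
    have := cω.spread i (j + 1) i j (by omega) (by omega)
    unfold gapAt
    linarith
  have eε : 4 * (1 + 15 * c) * ε = 4 * (ε + 15 * (c * ε)) := by ring
  rw [div_div (1 / 2 : ℝ), eε]
  have cond_config : ∀ G : Set Ω, ∀ᵐ ω ∂μ[|G], IsConfig 3 twoPos T fun i => x i ω :=
    fun G => cond_absolutelyContinuous.ae_le hs.config
  have cond_prob : ∀ G : Set Ω, 1 / 4 ≤ μ.real G → IsProbabilityMeasure μ[|G] := fun G hG4 =>
    cond_isProbabilityMeasure fun h0 => by
      rw [measureReal_def, h0] at hG4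
      norm_num at hG4
  rcases le_total (1 / 4) (μ.real (⋂ k, A k)) with g | g
  · have := cond_prob _ g
    have law := (hs.law.comp u).cond {v | Up K v 0} (⋂ k, A k) (fun k => Set.iInter_subset A k) AG
      (by positivity) g
    have mem : ∀ᵐ ω ∂μ[|⋂ k, A k], ω ∈ ⋂ k, A k := ae_cond_mem MeasurableSet.of_discrete
    refine (law.map fun v => gapAt v 1 / gapAt v 0).expTwoIter_two_le (by positivity)
      (fun k => ?_) (fun k => ?_) 0 1 2 ?_
    · filter_upwards [cond_config _, mem] with ω cω mω
      have p := (size ω cω (u k) 0 (by norm_num)).1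
      have q : Up K (x (u k) ω) 0 := Set.mem_iInter.1 mω k
      unfold Up at q
      rw [le_div_iff₀ (by linarith)]
      nlinarith
    · filter_upwards [cond_config _] with ω cω
      have p := (size ω cω (u k) 0 (by norm_num)).1
      have q := size ω cω (u k) 1 (by norm_num)
      rw [div_le_iff₀ (by linarith)]
      nlinarith
    · filter_upwards [cond_config _] with ω cω
      have p := fun k j hj => (size ω cω (u k) j hj).1
      have pos : ∀ k j, j < 2 → 0 < gapAt (x (u k) ω) j := fun k j hj => by linarith [p k j hj]
      exact ratio_mul_le (pos _ _ (by norm_num)) (pos _ _ (by norm_num)) (pos _ _ (by norm_num))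
        (pos _ _ (by norm_num)) (pos _ _ (by norm_num))
        (cω.gapAt_le (i := u 0) (i' := u 1) (j := 0) (k := 0) (by norm_num) (by norm_num)
          (by decide) (by decide))
        (cω.gapAt_le (i := u 1) (i' := u 2) (j := 1) (k := 0) (by norm_num) (by norm_num)
          (by decide) (by decide))
        (cω.gapAt_le (i := u 2) (i' := u 0) (j := 1) (k := 1) (by norm_num) (by norm_num)
          (by decide) (by decide))
  · have g' : 1 / 4 ≤ μ.real (⋂ k, B k) := by linarith
    have := cond_prob _ g'
    have law := (hs.law.comp d).cond {v | Down K v 0} (⋂ k, B k) (fun k => Set.iInter_subset B k) BG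
      (by positivity) g'
    have mem : ∀ᵐ ω ∂μ[|⋂ k, B k], ω ∈ ⋂ k, B k := ae_cond_mem MeasurableSet.of_discrete
    refine (law.map fun v => gapAt v 0 / gapAt v 1).expTwoIter_two_le (by positivity)
      (fun k => ?_) (fun k => ?_) 0 1 2 ?_
    · filter_upwards [cond_config _, mem] with ω cω mω
      have p := (size ω cω (d k) 1 (by norm_num)).1
      have q : Down K (x (d k) ω) 0 := Set.mem_iInter.1 mω k
      unfold Down at q
      simp only [zero_add] at q
      rw [le_div_iff₀ (by linarith)]
      nlinarith
    · filter_upwards [cond_config _] with ω cω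
      have p := (size ω cω (d k) 1 (by norm_num)).1
      have q := size ω cω (d k) 0 (by norm_num)
      rw [div_le_iff₀ (by linarith)]
      nlinarith
    · filter_upwards [cond_config _] with ω cω
      have p := fun k j hj => (size ω cω (d k) j hj).1
      have pos : ∀ k j, j < 2 → 0 < gapAt (x (d k) ω) j := fun k j hj => by linarith [p k j hj]
      exact ratio_mul_le (pos _ _ (by norm_num)) (pos _ _ (by norm_num)) (pos _ _ (by norm_num))
        (pos _ _ (by norm_num)) (pos _ _ (by norm_num))
        (cω.gapAt_le (i := d 0) (i' := d 1) (j := 1) (k := 1) (by norm_num) (by norm_num)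
          (by decide) (by decide))
        (cω.gapAt_le (i := d 1) (i' := d 2) (j := 0) (k := 1) (by norm_num) (by norm_num)
          (by decide) (by decide))
        (cω.gapAt_le (i := d 2) (i' := d 0) (j := 0) (k := 0) (by norm_num) (by norm_num)
          (by decide) (by decide))

end HeightTwo

/-! ### From positions to agendas -/

section Realization

open AgendaSymbol

theorem Agenda.isOcc_append {m : ℕ} (L₁ L₂ : Agenda m) (a : AgendaSymbol m) :
    Agenda.IsOcc (L₁ ++ a :: L₂) a (L₁.count a) L₁.length := by
  constructor <;> simp

/-- Occurrences in a concatenation are numbered by the counts in the preceding part. -/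
theorem Agenda.occBefore_append {m : ℕ} (L₁ L₂ L₃ : Agenda m) (a b : AgendaSymbol m) :
    Agenda.OccBefore (L₁ ++ a :: (L₂ ++ b :: L₃)) a (L₁.count a) b ((L₁ ++ a :: L₂).count b) := by
  refine ⟨L₁.length, (L₁ ++ a :: L₂).length, Agenda.isOcc_append _ _ _, ?_, by simp⟩
  have := Agenda.isOcc_append (L₁ ++ a :: L₂) L₃ b
  simpa using this

variable {ι : Type} {m n : ℕ}

open Classical in
/-- The players that have a node at position `p`. -/
noncomputable def playersAt (n : ℕ) (pos : ι → ℕ → ℕ) (f : ι → Fin m) (p : ℕ) : List (Fin m) :=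
  (List.finRange m).filter fun q => ∃ i j, j < n ∧ f i = q ∧ pos i j = p

/-- Many separators, followed by the nodes at position `p`. -/
noncomputable def nodeBlock (n : ℕ) (pos : ι → ℕ → ℕ) (f : ι → Fin m) (p : ℕ) : Agenda m :=
  List.replicate 42 sep ++ (playersAt n pos f p).map player

/-- The blocks of the positions below `P`. -/
noncomputable def blocks (n : ℕ) (pos : ι → ℕ → ℕ) (f : ι → Fin m) (P : ℕ) : Agenda m :=
  (List.range P).flatMap (nodeBlock n pos f)

/-- The agenda that realizes the positions: nodes at different positions are separated by `42`
separators, hence are at distance at least `40`. -/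
noncomputable def agendaOf (n : ℕ) (pos : ι → ℕ → ℕ) (f : ι → Fin m) (P : ℕ) : Agenda m :=
  blocks n pos f P ++ List.replicate 42 sep

variable {pos : ι → ℕ → ℕ} {f : ι → Fin m}

theorem mem_playersAt {p : ℕ} {q : Fin m} :
    q ∈ playersAt n pos f p ↔ ∃ i j, j < n ∧ f i = q ∧ pos i j = p := by
  simp [playersAt]

theorem nodup_playersAt (p : ℕ) : (playersAt n pos f p).Nodup := (List.nodup_finRange m).filter _

theorem player_injective : Function.Injective (player : Fin m → AgendaSymbol m) :=
  fun a b h => by cases h; rfl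

theorem count_sep_map_player (l : List (Fin m)) : (l.map player).count sep = 0 := by
  rw [List.count_eq_zero]
  simp

theorem count_player_replicate_sep (q : Fin m) (k : ℕ) :
    (List.replicate k (sep : AgendaSymbol m)).count (player q) = 0 := by
  rw [List.count_eq_zero]
  simp

theorem blocks_succ (p : ℕ) : blocks n pos f (p + 1) = blocks n pos f p ++ nodeBlock n pos f p := by
  simp [blocks, List.range_succ]

theorem count_sep_blocks (p : ℕ) : (blocks n pos f p).count sep = 42 * p := by
  induction p with
  | zero => simp [blocks]
  | succ p ih =>
    rw [blocks_succ, List.count_append, ih, nodeBlock, List.count_append, count_sep_map_player]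
    simp
    omega

theorem count_player_blocks_of_notMem {q : Fin m} (hq : ∀ i, f i ≠ q) (p : ℕ) :
    (blocks n pos f p).count (player q) = 0 := by
  induction p with
  | zero => simp [blocks]
  | succ p ih =>
    rw [blocks_succ, List.count_append, ih, nodeBlock, List.count_append,
      count_player_replicate_sep, List.count_map_of_injective _ _ player_injective,
      List.count_eq_zero_of_not_mem]
    rw [mem_playersAt]
    rintro ⟨i, _, _, h, _⟩
    exact hq i h

theorem pos_lt_pos (hpos : ∀ i j, j + 1 < n → pos i j < pos i (j + 1)) (i : ι) {j k : ℕ}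
    (hjk : j < k) (hk : k < n) : pos i j < pos i k := by
  induction k with
  | zero => omega
  | succ k ih =>
    rcases Nat.lt_succ_iff_lt_or_eq.1 hjk with h | rfl
    · exact (ih h (by omega)).trans (hpos i k hk)
    · exact hpos i j hk

theorem count_player_blocks (hf : Function.Injective f)
    (hpos : ∀ i j, j + 1 < n → pos i j < pos i (j + 1)) (i : ι) (p : ℕ) :
    (blocks n pos f p).count (player (f i)) = ((Finset.range n).filter (pos i · < p)).card := by
  induction p with
  | zero => simp [blocks]
  | succ p ih =>
    rw [blocks_succ, List.count_append, ih, nodeBlock, List.count_append,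
      count_player_replicate_sep, List.count_map_of_injective _ _ player_injective, zero_add]
    by_cases h : ∃ j, j < n ∧ pos i j = p
    · obtain ⟨j, hj, rfl⟩ := h
      rw [List.count_eq_one_of_mem (nodup_playersAt _) (mem_playersAt.2 ⟨i, j, hj, rfl, rfl⟩)]
      have : (Finset.range n).filter (pos i · < pos i j + 1) =
          insert j ((Finset.range n).filter (pos i · < pos i j)) := by
        ext k
        simp only [Finset.mem_filter, Finset.mem_range, Finset.mem_insert]
        constructor
        · rintro ⟨a, b⟩
          rcases lt_trichotomy k j with c | c | c
          · exact Or.inr ⟨a, pos_lt_pos hpos i c hj⟩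
          · exact Or.inl c
          · have := pos_lt_pos hpos i c a
            omega
        · rintro (rfl | ⟨a, b⟩)
          · exact ⟨hj, by omega⟩
          · exact ⟨a, by omega⟩
      rw [this, Finset.card_insert_of_notMem (by simp)]
    · rw [List.count_eq_zero_of_not_mem]
      · rw [add_zero]
        congr 1
        ext k
        simp only [Finset.mem_filter, Finset.mem_range]
        constructor
        · rintro ⟨a, b⟩
          exact ⟨a, by omega⟩
        · rintro ⟨a, b⟩
          refine ⟨a, lt_of_le_of_ne (by omega) fun e => h ⟨k, a, e⟩⟩
      · rw [mem_playersAt]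
        rintro ⟨i', j, hj, e, e'⟩
        obtain rfl := hf e
        exact h ⟨j, hj, e'⟩

theorem count_player_blocks_pos (hf : Function.Injective f)
    (hpos : ∀ i j, j + 1 < n → pos i j < pos i (j + 1)) (i : ι) {j : ℕ} (hj : j < n) :
    (blocks n pos f (pos i j)).count (player (f i)) = j := by
  rw [count_player_blocks hf hpos]
  have : (Finset.range n).filter (pos i · < pos i j) = Finset.range j := by
    ext k
    simp only [Finset.mem_filter, Finset.mem_range]
    constructor
    · rintro ⟨a, b⟩
      by_contra c
      rcases Nat.lt_or_ge j k with d | d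
      · have := pos_lt_pos hpos i d a
        omega
      · obtain rfl : k = j := by omega
        omega
    · intro a
      exact ⟨by omega, pos_lt_pos hpos i a hj⟩
  rw [this, Finset.card_range]

theorem count_player_agendaOf (hf : Function.Injective f)
    (hpos : ∀ i j, j + 1 < n → pos i j < pos i (j + 1)) {P : ℕ} (hP : ∀ i j, j < n → pos i j < P)
    (i : ι) : (agendaOf n pos f P).count (player (f i)) = n := by
  rw [agendaOf, List.count_append, count_player_replicate_sep, count_player_blocks hf hpos,
    Finset.filter_true_of_mem, Finset.card_range, add_zero]
  exact fun j hj => hP i j (Finset.mem_range.1 hj)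

theorem count_player_agendaOf_le (hf : Function.Injective f)
    (hpos : ∀ i j, j + 1 < n → pos i j < pos i (j + 1)) {P : ℕ} (hP : ∀ i j, j < n → pos i j < P)
    (q : Fin m) : (agendaOf n pos f P).count (player q) ≤ n := by
  by_cases h : ∃ i, f i = q
  · obtain ⟨i, rfl⟩ := h
    exact (count_player_agendaOf hf hpos hP i).le
  · push Not at h
    rw [agendaOf, List.count_append, count_player_replicate_sep, count_player_blocks_of_notMem h]
    omega

theorem count_sep_agendaOf (P : ℕ) : (agendaOf n pos f P).count sep = 42 * P + 42 := by
  simp [agendaOf, count_sep_blocks]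

theorem exists_agendaOf_eq {p P : ℕ} (h : p ≤ P) :
    ∃ L, agendaOf n pos f P = blocks n pos f p ++ (List.replicate 42 sep ++ L) := by
  obtain ⟨k, rfl⟩ := Nat.exists_eq_add_of_le h
  induction k with
  | zero => exact ⟨[], by simp [agendaOf]⟩
  | succ k ih =>
    obtain ⟨L, hL⟩ := ih (by omega)
    rcases k with _ | k
    · exact ⟨(playersAt n pos f p).map player ++ List.replicate 42 sep, by
        simp [agendaOf, blocks_succ, nodeBlock]⟩
    · refine ⟨L ++ ((playersAt n pos f (p + (k + 1))).map player ++ List.replicate 42 sep), ?_⟩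
      have e : agendaOf n pos f (p + (k + 1 + 1)) = agendaOf n pos f (p + (k + 1)) ++
          ((playersAt n pos f (p + (k + 1))).map player ++ List.replicate 42 sep) := by
        rw [← add_assoc, agendaOf, blocks_succ, nodeBlock, agendaOf]
        simp only [List.append_assoc]
      rw [e, hL]
      simp

/-- The last separator before, and the first one after, a given node. -/
theorem occBefore_agendaOf (hf : Function.Injective f)
    (hpos : ∀ i j, j + 1 < n → pos i j < pos i (j + 1)) {P : ℕ} (hP : ∀ i j, j < n → pos i j < P)
    (i : ι) {j : ℕ} (hj : j < n) :
    (agendaOf n pos f P).OccBefore sep (42 * pos i j + 41) (player (f i)) j ∧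
    (agendaOf n pos f P).OccBefore (player (f i)) j sep (42 * (pos i j + 1)) := by
  obtain ⟨L, hL⟩ := exists_agendaOf_eq (n := n) (pos := pos) (f := f)
    (show pos i j + 1 ≤ P from hP i j hj)
  obtain ⟨u, v, huv⟩ := List.append_of_mem
    (mem_playersAt.2 ⟨i, j, hj, rfl, rfl⟩ : f i ∈ playersAt n pos f (pos i j))
  have hu : f i ∉ u := by
    have := nodup_playersAt (n := n) (pos := pos) (f := f) (pos i j)
    rw [huv, List.nodup_append] at this
    exact fun h => this.2.2 _ h _ (by simp) rfl
  have cu : (u.map player).count (player (f i)) = 0 := by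
    rw [List.count_map_of_injective _ _ player_injective, List.count_eq_zero_of_not_mem hu]
  rw [blocks_succ, nodeBlock, huv] at hL
  constructor
  · have key := Agenda.occBefore_append (blocks n pos f (pos i j) ++ List.replicate 41 sep)
      (u.map player) (v.map player ++ (List.replicate 42 sep ++ L)) sep (player (f i))
    have e : agendaOf n pos f P = (blocks n pos f (pos i j) ++ List.replicate 41 sep) ++
        sep :: (u.map player ++ player (f i) ::
          (v.map player ++ (List.replicate 42 sep ++ L))) := by
      rw [hL, show List.replicate 42 (sep : AgendaSymbol m) = List.replicate 41 sep ++ [sep] from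
        List.replicate_succ' ..]
      simp
    rw [← e] at key
    convert key using 1
    · rw [List.count_append, count_sep_blocks]; simp
    · rw [List.count_append, List.count_cons, List.count_append,
        count_player_blocks_pos hf hpos i hj, count_player_replicate_sep, cu]
      simp
  · have key := Agenda.occBefore_append (blocks n pos f (pos i j) ++ List.replicate 42 sep ++
      u.map player) (v.map player) (List.replicate 41 sep ++ L) (player (f i)) sep
    have e : agendaOf n pos f P = (blocks n pos f (pos i j) ++ List.replicate 42 sep ++
      u.map player) ++ player (f i) :: (v.map player ++ sep :: (List.replicate 41 sep ++ L)) := by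
      rw [hL]
      simp [List.replicate_succ]
    rw [← e] at key
    convert key using 1
    · rw [List.count_append, List.count_append, count_player_blocks_pos hf hpos i hj,
        count_player_replicate_sep, cu, add_zero, add_zero]
    · simp only [List.count_append, List.count_cons, count_sep_blocks, count_sep_map_player]
      simp
      omega

end Realization

section TotalVariation

theorem toOuterMeasure_le_add_tvDist {α : Type*} (p q : PMF α) (S : Set α) :
    p.toOuterMeasure S ≤ q.toOuterMeasure S + tvDist p q := by
  rw [PMF.toOuterMeasure_apply, PMF.toOuterMeasure_apply, tvDist, ← ENNReal.tsum_add]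
  refine ENNReal.tsum_le_tsum fun a => ?_
  by_cases h : a ∈ S
  · simp only [Set.indicator_of_mem h]
    exact le_add_tsub
  · simp [Set.indicator_of_notMem h]

variable {Ω : Type*}

theorem ae_mem_support [MeasurableSpace Ω] [DiscreteMeasurableSpace Ω] (X : PMF Ω) :
    ∀ᵐ ω ∂X.toMeasure, ω ∈ X.support := by
  rw [ae_iff, PMF.toMeasure_apply_eq_zero_iff _ MeasurableSet.of_discrete]
  exact Set.disjoint_left.2 fun a h h' => h' h

theorem measureReal_preimage_le_of_tvDist_le {α : Type*} [MeasurableSpace Ω]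
    [DiscreteMeasurableSpace Ω] (X : PMF Ω) {ε : ℝ} (hε : 0 ≤ ε) (u v : Ω → α)
    (h : tvDist (X.map u) (X.map v) ≤ ENNReal.ofReal ε) (S : Set α) :
    X.toMeasure.real (u ⁻¹' S) ≤ X.toMeasure.real (v ⁻¹' S) + ε := by
  have key := (toOuterMeasure_le_add_tvDist (X.map u) (X.map v) S).trans (add_le_add_right h _)
  rw [PMF.toOuterMeasure_map_apply, PMF.toOuterMeasure_map_apply,
    ← PMF.toMeasure_apply_eq_toOuterMeasure_apply _ MeasurableSet.of_discrete,
    ← PMF.toMeasure_apply_eq_toOuterMeasure_apply _ MeasurableSet.of_discrete] at key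
  have := ENNReal.toReal_mono (by finiteness) key
  rwa [ENNReal.toReal_add (by finiteness) (by finiteness), ENNReal.toReal_ofReal hε] at this

end TotalVariation

/-! ### The lower bound for timings -/

section Times

open AgendaSymbol

variable {m : ℕ} {A : Agenda m} {ε lam : ℝ} {X : PMF A.Times}

theorem Agenda.IsTiming.sep_add_le (h : A.IsTiming ε lam X) {ω : A.Times} (hω : ω ∈ X.support)
    (d : ℕ) : ∀ (s t : Fin (A.count sep)), s.val + d = t.val → ω sep s + d ≤ ω sep t := by
  induction d with
  | zero =>
    intro s t hst
    obtain rfl : s = t := Fin.ext (by omega)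
    simp
  | succ d ih =>
    intro s t hst
    have a := ih s ⟨s.val + d, by omega⟩ rfl
    have b := h.sep_gap ω hω ⟨s.val + d, by omega⟩ t (by simp only; omega)
    push_cast
    linarith

theorem Agenda.IsTiming.le_sep (h : A.IsTiming ε lam X) {ω : A.Times} (hω : ω ∈ X.support)
    (t : Fin (A.count sep)) : (t.val : ℝ) ≤ ω sep t := by
  have a := h.sep_nonneg ω hω ⟨0, t.pos⟩
  have b := h.sep_add_le hω t.val ⟨0, t.pos⟩ t (by simp)
  linarith

/-- Extension of a tuple by zero. Vectors of nodes of players with equal numbers of nodes become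
elements of a common type. -/
def extendZero {c : ℕ} (v : Fin c → ℝ) (j : ℕ) : ℝ := if h : j < c then v ⟨j, h⟩ else 0

theorem extendZero_cast {c c' : ℕ} (h : c = c') (v : Fin c' → ℝ) :
    extendZero (fun j => v (Fin.cast h j)) = extendZero v := by
  subst h
  rfl

/-- A hard arrangement yields an agenda whose timings need much time. -/
theorem exists_agenda_of_isHard {ι : Type} [Fintype ι] {r n : ℕ} (hr : 1 ≤ r)
    (hcard : Fintype.card ι ≤ m) (pos : ι → ℕ → ℕ)
    (hpos : ∀ i j, j + 1 < n → pos i j < pos i (j + 1)) (hh : IsHard r n pos) :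
    ∃ (k ε₀ : ℝ) (A : Agenda m), 0 < k ∧ 0 < ε₀ ∧ (∀ i, A.count (player i) ≤ n) ∧
      ∀ (ε : ℝ), 0 < ε → ε ≤ ε₀ → ∀ X : PMF A.Times,
        A.IsTiming ε (ε ^ (1 - 1 / (r : ℝ)) / 10) X →
          Agenda.NeedsTime X
            (expTwoIter r (k * ε ^ (-(1 / ((r ! : ℝ) * ((r - 1)! : ℝ)))))) := by
  obtain ⟨k, ε₀, hk, hε₀, H⟩ := hh
  obtain ⟨f⟩ : Nonempty (ι ↪ Fin m) := Function.Embedding.nonempty_of_card_le (by simpa using hcard)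
  obtain ⟨P, hP⟩ := exists_forall_pos_lt n pos
  obtain ⟨A, hA⟩ : ∃ A : Agenda m, A = agendaOf n pos f P := ⟨_, rfl⟩
  refine ⟨k, min ε₀ 1, A, hk, by positivity,
    hA ▸ count_player_agendaOf_le f.injective hpos hP, ?_⟩
  intro ε hε hle X hX
  have hle1 : ε ≤ 1 := hle.trans (min_le_right _ _)
  set lam := ε ^ (1 - 1 / (r : ℝ)) / 10 with hlam
  have hr' : (1 : ℝ) ≤ r := by exact_mod_cast hr
  have lam1 : lam ≤ 1 / 10 := by
    have : ε ^ (1 - 1 / (r : ℝ)) ≤ 1 := by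
      refine Real.rpow_le_one hε.le hle1 ?_
      rw [sub_nonneg, div_le_one (by linarith)]
      exact hr'
    rw [hlam]
    linarith
  set T := expTwoIter r (k * ε ^ (-(1 / ((r ! : ℝ) * ((r - 1)! : ℝ))))) with hT
  -- The exponent of `1 / ε` in the statement is at most `1`.
  have hTle : T ≤ expTwoIter r (k / ε) := by
    refine expTwoIter_mono r ?_
    rw [div_eq_mul_inv k ε, ← Real.rpow_neg_one ε]
    refine mul_le_mul_of_nonneg_left ?_ hk.le
    refine Real.rpow_le_rpow_of_exponent_ge hε hle1 (neg_le_neg ?_)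
    have a : (1 : ℝ) ≤ (r ! : ℝ) := by
      exact_mod_cast Nat.one_le_iff_ne_zero.2 (Nat.factorial_ne_zero r)
    have b : (1 : ℝ) ≤ ((r - 1)! : ℝ) := by
      exact_mod_cast Nat.one_le_iff_ne_zero.2 (Nat.factorial_ne_zero (r - 1))
    rw [div_le_one (by positivity)]
    nlinarith
  by_contra hneed
  have hlt : ∀ ω ∈ X.support, ∀ a (j : Fin (A.count a)), ω a j < T := by
    intro ω hω a j
    by_contra hge
    exact hneed ⟨ω, hω, a, j, not_lt.1 hge⟩
  have hcount : ∀ i, A.count (player (f i)) = n :=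
    hA ▸ count_player_agendaOf f.injective hpos hP
  let _ : MeasurableSpace A.Times := ⊤
  have : DiscreteMeasurableSpace A.Times := ⟨fun _ => trivial⟩
  set x : ι → A.Times → ℕ → ℝ := fun i ω => extendZero (ω (player (f i))) with hx
  have xj : ∀ i (ω : A.Times) j (hj : j < n),
      x i ω j = ω (player (f i)) ⟨j, by rw [hcount]; exact hj⟩ := by
    intro i ω j hj
    simp only [hx, extendZero]
    rw [dif_pos]
  have sepLt : ∀ i j, j < n → 42 * (pos i j + 1) < A.count sep := by
    intro i j hj
    have := hP i j hj
    rw [hA, count_sep_agendaOf]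
    omega
  have upper : ∀ ω ∈ X.support, ∀ i j (hj : j < n),
      x i ω j ≤ ω sep ⟨42 * (pos i j + 1), sepLt i j hj⟩ + lam := by
    intro ω hω i j hj
    rw [xj i ω j hj]
    exact hX.before_sep ω hω (f i) ⟨j, _⟩ ⟨_, sepLt i j hj⟩
      (hA ▸ occBefore_agendaOf f.injective hpos hP i hj).2
  have lower : ∀ ω ∈ X.support, ∀ i j (hj : j < n),
      ω sep ⟨42 * pos i j + 41, by linarith [sepLt i j hj]⟩ - lam ≤ x i ω j := by
    intro ω hω i j hj
    rw [xj i ω j hj]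
    exact hX.after_sep ω hω (f i) ⟨j, _⟩ ⟨_, by linarith [sepLt i j hj]⟩
      (hA ▸ occBefore_agendaOf f.injective hpos hP i hj).1
  have apart : ∀ ω ∈ X.support, ∀ i j i' j', j < n → j' < n → pos i j < pos i' j' →
      x i ω j + 40 ≤ x i' ω j' := by
    intro ω hω i j i' j' hj hj' hlt
    have a := upper ω hω i j hj
    have b := lower ω hω i' j' hj'
    have c := hX.sep_add_le hω (42 * pos i' j' + 41 - 42 * (pos i j + 1)) ⟨_, sepLt i j hj⟩
      ⟨42 * pos i' j' + 41, by linarith [sepLt i' j' hj']⟩ (by simp only; omega)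
    have d : (41 : ℝ) ≤ ((42 * pos i' j' + 41 - 42 * (pos i j + 1) : ℕ) : ℝ) := by
      exact_mod_cast (by omega : 41 ≤ 42 * pos i' j' + 41 - 42 * (pos i j + 1))
    linarith
  -- A node is preceded by at least `42` separators, so its time exceeds `1`. If all times are below
  -- `T`, their differences are bounded by `T - 1`.
  have system : IsSystem X.toMeasure n pos ε (T - 1) x := by
    refine ⟨fun i i' S => ?_, ?_⟩
    · have hc : A.count (player (f i)) = A.count (player (f i')) := by rw [hcount, hcount]
      have := measureReal_preimage_le_of_tvDist_le X hε.le _ _ (hX.tvDist_le (f i) (f i') hc)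
        (extendZero ⁻¹' S)
      refine this.trans_eq ?_
      congr 2
      ext ω
      simp only [Set.mem_preimage, extendZero_cast hc, hx]
    · filter_upwards [ae_mem_support X] with ω hω
      refine ⟨fun i j i' j' hj hj' hlt => ?_, fun i j hj => ?_, fun i j i' j' hj hj' => ?_⟩
      · linarith [apart ω hω i j i' j' hj hj' hlt]
      · exact apart ω hω i j i (j + 1) (by omega) hj (hpos i j hj)
      · have a := lower ω hω i' j' hj'
        have b := hX.le_sep hω ⟨42 * pos i' j' + 41, by linarith [sepLt i' j' hj']⟩
        have c : x i ω j < T := by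
          rw [xj i ω j hj]
          exact hlt ω hω _ _
        push_cast at b
        have d : (0 : ℝ) ≤ pos i' j' := Nat.cast_nonneg _
        linarith
  have := H A.Times X.toMeasure ε (T - 1) x hε (hle.trans (min_le_left _ _)) system
  linarith

end Times

theorem mainTheorem2 (r : ℕ) (hr : 1 ≤ r) :
    ∃ (k ε₀ : ℝ) (A : Agenda (16 * r - 13)), 0 < k ∧ 0 < ε₀ ∧
      (∀ i, A.count (AgendaSymbol.player i) ≤ max 3 (3 * (r - 1))) ∧
      ∀ (ε : ℝ), 0 < ε → ε ≤ ε₀ → ∀ X : PMF A.Times,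
        A.IsTiming ε (ε ^ (1 - 1 / (r : ℝ)) / 10) X →
          Agenda.NeedsTime X
            (expTwoIter r (k * ε ^ (-(1 / ((r ! : ℝ) * ((r - 1)! : ℝ)))))) := by
  obtain ⟨ι, _, n, pos, hcard, hn, hpos, hh⟩ : ∃ (ι : Type) (_ : Fintype ι) (n : ℕ)
      (pos : ι → ℕ → ℕ), Fintype.card ι ≤ 16 * r - 13 ∧ n ≤ max 3 (3 * (r - 1)) ∧
      (∀ i j, j + 1 < n → pos i j < pos i (j + 1)) ∧ IsHard r n pos := by
    by_cases h2 : r = 2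
    · subst h2
      exact ⟨_, inferInstance, 3, twoPos, by simp, by simp, twoPos_lt_succ, isHard_two⟩
    · obtain ⟨s, rfl⟩ := Nat.exists_eq_add_of_le' hr
      obtain ⟨ι, inst, pos, hcard, hpos, hh⟩ := exists_isHard s
      exact ⟨ι, inst, 2 * s + 2, pos, by omega, by omega, hpos, hh⟩
  obtain ⟨k, ε₀, A, hk, hε₀, hA, H⟩ := exists_agenda_of_isHard hr hcard pos hpos hh
  exact ⟨k, ε₀, A, hk, hε₀, fun i => (hA i).trans hn, H⟩
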